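/- Notation. For an integer $j$, $P^j$ denotes polynomials of total degree $\le j$ (with $P^j=\{0\}$ for $j<0$), $\tilde P^j$ homogeneous polynomials of degree $j$, and $Q^{i,j}=P^i\otimes P^j$ polynomials of degree $\le i$ in the first and $\le j$ in the second variable. Let $T^3$ be the tetrahedron with vertices $(1,-1,-1),(-1,1,-1),(-1,-1,1),(-1,-1,-1)$ and barycentric coordinates $\lambda_1,\dots,\lambda_4$ (in this order), let $T^1=[-1,1]$, and let $W^4=T^3\times T^1=\{x\in\mathbb R^4: -1\le x_i\le 1,\ x_1+x_2+x_3\le -1\}$ be the reference tetrahedral prism. $P^j(T^3)$ are polynomials in $x_1,x_2,x_3$, $P^j(T^1)$ polynomials in $x_4$, and $\otimes$ between them denotes the span of products. For an integer $k\ge 0$ let the space of 1-form proxies be $$V^{k,1}(W^4)=P^k(T^1)\otimes\Big(\{p\in[\tilde P^k(T^3),\tilde P^k(T^3),\tilde P^k(T^3),0]^T: p\cdot x=0\}\oplus[P^{k-1}(T^3),P^{k-1}(T^3),P^{k-1}(T^3),0]^T\Big)\ \oplus\ P^k(T^3)\otimes[0,0,0,P^{k-1}(T^1)]^T .$$ Put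 $\vartheta^b(x_4)=\tfrac{1-x_4}{2}\cdot\tfrac{1+x_4}{2}$, $\vartheta^b(x_1,x_2,x_3)=\lambda_1\lambda_2\lambda_3\lambda_4$ and, for $r=1,2,3$ and $(a,b,c,d)=(1,2,3,4),(2,3,4,1),(3,4,1,2)$ respectively, $\Phi^{b,r}=\lambda_c\lambda_d$ and $N^r=\lambda_a\nabla\lambda_b-\lambda_b\nabla\lambda_a$. The bubble space is $$\mathring V^{k,1}(W^4)=\mathrm{span}\Big\{\Phi^{b,r}\,\vartheta^b(x_4)\,g\,p\begin{bmatrix}N^r\\0\end{bmatrix}: r\in\{1,2,3\},\ g\in P^{k-3}(T^3),\ p\in P^{k-2}(T^1)\Big\}\oplus\mathrm{span}\Big\{[0,0,0,\vartheta^b(x_1,x_2,x_3)\,p\,v]^T: p\in P^{k-4}(T^3),\ v\in P^{k-1}(T^1)\Big\}.$$ The degrees of freedom $\Sigma^{k,1}(W^4)$ of a field $E$ are the following moments, where $\mathrm{Tr}\,E$ is the tangential part of $E$ on the face in question and polynomials on a face are polynomials in its affine coordinates. Trace degrees of freedom: * for each of the 16 edges $e$, with unit tangent $\tau$: $\int_e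 (E\cdot\tau)\,q$, $q\in P^{k-1}(e)$; * for each of the 8 triangular faces $f$ (with unit normal $\nu$ in a tetrahedral facet): $\int_f(\mathrm{Tr}E\times\nu)\cdot(q\times\nu)=\int_f \mathrm{Tr}E\cdot q$ for all tangential $q\in(P^{k-2}(f))^2$; * for each of the 6 quadrilateral faces $f$, the product of an edge of $T^3$ with $T^1$: $\int_f(\mathrm{Tr}E\times\nu)\cdot q$, $q\in Q^{k-2,k-1}\times Q^{k-1,k-2}(f)$, where $\mathrm{Tr}E\times\nu$ is the tangential trace rotated by a right angle in the plane of $f$, with components $(E_4,-E\cdot\tau)$ in the frame $(\tau,e_4)$, $\tau$ being the unit vector along the edge; * for each of the 2 tetrahedral facets $F$: $\int_F\mathrm{Tr}E\cdot q$, $q\in(P^{k-3}(F))^3$; * for each of the 4 triangular-prism facets $F=f\times T^1$, $f$ a triangular face of $T^3$: $\int_F\mathrm{Tr}E\cdot q$ for all $q\in P^{k-2}(T^1)\otimes[P^{k-2}(f),P^{k-2}(f),0]^T$ and for all $q\in P^{k-1}(T^1)\otimes[0,0,P^{k-3}(f)]^T$ (the third component is the one along $x_4$). Volume degrees of freedom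 $\Sigma_{vol,1}\cup\Sigma_{vol,2}$: * $\int_{W^4}E\cdot\sum_{r=1}^3 q^r\,\Phi^{b,r}\,\vartheta^b(x_4)\begin{bmatrix}N^r\\0\end{bmatrix}$, $q^1,q^2,q^3\in P^{k-2}(T^1)\otimes P^{k-3}(T^3)$; * $\int_{W^4}E\cdot[0,0,0,q^4\,\vartheta^b(x_1,x_2,x_3)]^T$, $q^4\in P^{k-1}(T^1)\otimes P^{k-4}(T^3)$. Lemma (unisolvency for 1-forms on $W^4$). Let $k\ge0$ and $E\in V^{k,1}(W^4)$. 1. If all trace degrees of freedom of $E$ vanish, then $E\in\mathring V^{k,1}(W^4)$. 2. If all degrees of freedom of $E$ (trace and volume) vanish, then $E\equiv0$. -/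

import Mathlib

open MvPolynomial MeasureTheory

noncomputable section

namespace TetPrism

/-! ## Polynomial spaces -/

/-- Real polynomials that involve only the variables in `s` and have total degree `≤ j`
(the zero space when `j < 0`). -/
def polyOn {ι : Type*} (s : Set ι) (j : ℤ) : Submodule ℝ (MvPolynomial ι ℝ) :=
  restrictSupport ℝ {m | (m.support : Set ι) ⊆ s ∧ (m.degree : ℤ) ≤ j}

/-- Polynomials in `x₁, x₂, x₃, x₄`; the coordinates are numbered `0, 1, 2, 3` here. -/
abbrev Poly4 := MvPolynomial (Fin 4) ℝ

/-- Polynomial 1-form proxies: 4-vectors `E = (E₁, E₂, E₃, E₄)` of polynomials. -/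
abbrev Field4 := Fin 4 → Poly4

/-- `P^j(T³)`: polynomials in `x₁, x₂, x₃` of degree `≤ j`. -/
def polyT3 (j : ℤ) : Submodule ℝ Poly4 := polyOn {0, 1, 2} j

/-- `P^j(T¹)`: polynomials in `x₄` of degree `≤ j`. -/
def polyT1 (j : ℤ) : Submodule ℝ Poly4 := polyOn {3} j

/-- The tensor product `P^i(T¹) × P^j(T³)`: the linear span of all products. -/
def polyTensor (i j : ℤ) : Submodule ℝ Poly4 := polyT1 i * polyT3 j

/-! ## The space of 1-forms on the tetrahedral prism -/

/-- `[P^{k-1}(T³), P^{k-1}(T³), P^{k-1}(T³), 0]ᵀ`. -/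
def nedelecLow (k : ℕ) : Submodule ℝ Field4 :=
  Submodule.span ℝ {p | p 3 = 0 ∧ ∀ i, p i ∈ polyT3 ((k : ℤ) - 1)}

/-- The fields `p` whose first three components are homogeneous of degree `k` in `x₁, x₂, x₃`,
with `p₄ = 0` and `p · x = 0`. -/
def nedelecHom (k : ℕ) : Submodule ℝ Field4 :=
  Submodule.span ℝ {p | p 3 = 0 ∧ (∀ i, p i ∈ polyT3 k ∧ (p i).IsHomogeneous k) ∧
    ∑ i, p i * X i = 0}

/-- The 1-form space
`P^k(T¹) × ({p ∈ (P̃^k(T³))³ : p · x = 0} ⊕ (P^{k-1}(T³))³) ⊕ P^k(T³) × [0, 0, 0, P^{k-1}(T¹)]ᵀ`. -/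
def oneForms (k : ℕ) : Submodule ℝ Field4 :=
  Submodule.span ℝ {E | ∃ a ∈ polyT1 k, ∃ p ∈ nedelecHom k ⊔ nedelecLow k, E = a • p} ⊔
  Submodule.span ℝ {E | ∃ b ∈ polyTensor ((k : ℤ) - 1) k, E = Pi.single 3 b}

/-! ## Bubble functions and the bubble space -/

/-- Barycentric coordinates `λ₁, λ₂, λ₃, λ₄` of the tetrahedron with vertices
`(1,-1,-1), (-1,1,-1), (-1,-1,1), (-1,-1,-1)`. -/
def bary (i : Fin 4) : Poly4 :=
  if i = 3 then C (-1 / 2) * (X 0 + X 1 + X 2 + 1) else C (1 / 2) * (X i + 1)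

/-- The tetrahedral bubble `ϑᵇ(x₁, x₂, x₃) = λ₁ λ₂ λ₃ λ₄`. -/
def bubbleT3 : Poly4 := bary 0 * bary 1 * bary 2 * bary 3

/-- The segment bubble `ϑᵇ(x₄) = ν₁ ν₂`, with `ν₁ = (1 - x₄)/2` and `ν₂ = (1 + x₄)/2`. -/
def bubbleT1 : Poly4 := C (1 / 2) * (1 - X 3) * (C (1 / 2) * (1 + X 3))

/-- The gradient. The barycentric coordinates do not depend on `x₄`, so their gradients have
fourth component `0`. -/
def grad (u : Poly4) : Field4 := fun i => pderiv i u

/-- `[Nʳ, 0]ᵀ` with `Nʳ = λ_a ∇λ_b - λ_b ∇λ_a`. For `r = 1, 2, 3` the indices `(a, b, c, d)` are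
`(1,2,3,4), (2,3,4,1), (3,4,1,2)`, i.e. `(r, r+1, r+2, r+3)` modulo `4`. -/
def whitney (r : Fin 3) : Field4 :=
  bary r.castSucc • grad (bary (r.castSucc + 1)) - bary (r.castSucc + 1) • grad (bary r.castSucc)

/-- `Φ^{b,r} = λ_c λ_d`. -/
def phiB (r : Fin 3) : Poly4 := bary (r.castSucc + 2) * bary (r.castSucc + 3)

/-- The bubble space: the span of the fields `Φ^{b,r} ϑᵇ(x₄) g p [Nʳ, 0]ᵀ` with
`g ∈ P^{k-3}(T³)`, `p ∈ P^{k-2}(T¹)`, `r = 1, 2, 3`, plus the span of the fields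
`[0, 0, 0, ϑᵇ(x₁,x₂,x₃) p v]ᵀ` with `p ∈ P^{k-4}(T³)`, `v ∈ P^{k-1}(T¹)`. -/
def oneFormBubbles (k : ℕ) : Submodule ℝ Field4 :=
  Submodule.span ℝ {E | ∃ r : Fin 3, ∃ g ∈ polyT3 ((k : ℤ) - 3), ∃ p ∈ polyT1 ((k : ℤ) - 2),
    E = (phiB r * bubbleT1 * g * p) • whitney r} ⊔
  Submodule.span ℝ {E | ∃ p ∈ polyT3 ((k : ℤ) - 4), ∃ v ∈ polyT1 ((k : ℤ) - 1),
    E = Pi.single 3 (bubbleT3 * p * v)}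

/-! ## Geometry of the tetrahedral prism -/

/-- The reference tetrahedral prism
`W⁴ = {-1 ≤ x₁, x₂, x₃, x₄ ≤ 1, x₁ + x₂ + x₃ ≤ -1}`. -/
def prism : Set (Fin 4 → ℝ) := {x | (∀ i, -1 ≤ x i ∧ x i ≤ 1) ∧ x 0 + x 1 + x 2 ≤ -1}

/-- The `i`-th vertex of the tetrahedron at height `x₄ = z`; the eight vertices of `W⁴` are those
with `z = -1` and `z = 1`. -/
def vertex (i : Fin 4) (z : ℝ) : Fin 4 → ℝ :=
  fun j => if j = 3 then z else if j = i then 1 else -1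

/-- The direction `(0, 0, 0, 1)`. -/
def e4 : Fin 4 → ℝ := Pi.single 3 1

/-- The `d`-dimensional faces of the tetrahedron (`d ≤ 3`), given by their `d + 1` vertices in
increasing order. Each of them has, at the heights `±1`, two horizontal copies of dimension `d` in
`∂W⁴`, and it has the vertical product with `[-1, 1]`, of dimension `d + 1`. -/
abbrev TetFace (d : ℕ) := Fin (d + 1) ↪o Fin 4

/-- The edge vectors of a face of the tetrahedron that issue from its first vertex. They are a
basis of the tangent space of the face. -/
def tangent {d : ℕ} (σ : TetFace d) (i : Fin d) : Fin 4 → ℝ :=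
  vertex (σ i.succ) 0 - vertex (σ 0) 0

/-- Affine parametrization of a face of the tetrahedron, at height `z`, by the unit simplex. -/
def facePoint {d : ℕ} (σ : TetFace d) (s : Fin d → ℝ) (z : ℝ) : Fin 4 → ℝ :=
  vertex (σ 0) z + ∑ i, s i • tangent σ i

/-- Jacobian of the parametrization: the `d`-dimensional volume of the parallelepiped spanned
by the edge vectors, i.e. the square root of their Gram determinant. -/
def faceJac {d : ℕ} (σ : TetFace d) : ℝ :=
  √(Matrix.det (Matrix.of fun i j => tangent σ i ⬝ᵥ tangent σ j))

/-- The unit `d`-simplex, parameter domain of the horizontal faces. -/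
def simplexDom (d : ℕ) : Set (Fin d → ℝ) := {s | (∀ i, 0 ≤ s i) ∧ ∑ i, s i ≤ 1}

/-- The unit `d`-simplex times `[-1, 1]`, parameter domain of the vertical faces. The last
coordinate is the height `x₄`. -/
def prismDom (d : ℕ) : Set (Fin (d + 1) → ℝ) :=
  {y | Fin.init y ∈ simplexDom d ∧ -1 ≤ y (Fin.last d) ∧ y (Fin.last d) ≤ 1}

/-- Integral, with respect to `d`-dimensional surface measure, over a horizontal copy of the
face `σ`, of a function given in the parameters of the face. -/
def horizInt {d : ℕ} (σ : TetFace d) (f : (Fin d → ℝ) → ℝ) : ℝ :=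
  faceJac σ * ∫ s in simplexDom d, f s

/-- Integral, with respect to `(d+1)`-dimensional surface measure, over the product of the face
`σ` with `[-1, 1]`, of a function given in the parameters of the face. -/
def vertInt {d : ℕ} (σ : TetFace d) (f : (Fin (d + 1) → ℝ) → ℝ) : ℝ :=
  faceJac σ * ∫ y in prismDom d, f y

/-- Value of a polynomial field at a point. -/
def fieldAt (E : Field4) (x : Fin 4 → ℝ) : Fin 4 → ℝ := fun i => eval x (E i)

/-- Value of `E` on the horizontal copy at height `z` of the face `σ`. -/
def onHoriz {d : ℕ} (E : Field4) (σ : TetFace d) (z : ℝ) (s : Fin d → ℝ) : Fin 4 → ℝ :=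
  fieldAt E (facePoint σ s z)

/-- Value of `E` on the vertical face above `σ`. -/
def onVert {d : ℕ} (E : Field4) (σ : TetFace d) (y : Fin (d + 1) → ℝ) : Fin 4 → ℝ :=
  fieldAt E (facePoint σ (Fin.init y) (y (Fin.last d)))

/-- The unit tangent vector of an edge of the tetrahedron. -/
def unitTangent (σ : TetFace 1) : Fin 4 → ℝ :=
  (√(tangent σ 0 ⬝ᵥ tangent σ 0))⁻¹ • tangent σ 0

/-- `P^i` in the height times `P^j` in the simplex parameters, on a vertical face. -/
def vertPoly (d : ℕ) (i j : ℤ) : Submodule ℝ (MvPolynomial (Fin (d + 1)) ℝ) :=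
  polyOn {Fin.last d} i * polyOn (Set.range Fin.castSucc) j

/-! ## Degrees of freedom

Polynomials on a face are polynomials in its affine parameters. The trace `Tr(E)` on a face is the
tangential part of `E`, and pairing it with a tangential field is the same as pairing `E` with
that field. -/

/-- The 12 horizontal edges: `∫_e (Tr E · τ) q`, `q ∈ P^{k-1}(e)`. -/
def horizEdgeDofs (k : ℕ) : Set (Field4 → ℝ) :=
  {M | ∃ σ : TetFace 1, ∃ z : ℝ, (z = -1 ∨ z = 1) ∧
    ∃ q ∈ polyOn (Set.univ : Set (Fin 1)) ((k : ℤ) - 1),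
    M = fun E => horizInt σ fun s => (onHoriz E σ z s ⬝ᵥ unitTangent σ) * eval s q}

/-- The 4 vertical edges: `∫_e (Tr E · τ) q`, `q ∈ P^{k-1}(e)`. -/
def vertEdgeDofs (k : ℕ) : Set (Field4 → ℝ) :=
  {M | ∃ σ : TetFace 0, ∃ q ∈ polyOn (Set.univ : Set (Fin 1)) ((k : ℤ) - 1),
    M = fun E => vertInt σ fun y => (onVert E σ y ⬝ᵥ e4) * eval y q}

/-- The 8 triangles: `∫_f (Tr E × ν) · (q × ν)` over tangential `q ∈ (P^{k-2}(f))²`, `ν` being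
the unit normal. Crossing with `ν` is a rotation by a right angle in the tangent plane, so the
integrand is `E · q`. -/
def triangleDofs (k : ℕ) : Set (Field4 → ℝ) :=
  {M | ∃ σ : TetFace 2, ∃ z : ℝ, (z = -1 ∨ z = 1) ∧
    ∃ q : Fin 2 → MvPolynomial (Fin 2) ℝ, (∀ i, q i ∈ polyOn Set.univ ((k : ℤ) - 2)) ∧
    M = fun E => horizInt σ fun s => onHoriz E σ z s ⬝ᵥ ∑ i, eval s (q i) • tangent σ i}

/-- The 6 quadrilaterals: `∫_f (Tr E × ν) · q`, `q ∈ Q^{k-2,k-1} × Q^{k-1,k-2}(f)`. In the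
orthonormal frame `(τ, e₄)` of the face and with `ν = τ × e₄`, the components of `Tr E × ν` are
`E · e₄` and `-E · τ`. -/
def quadDofs (k : ℕ) : Set (Field4 → ℝ) :=
  {M | ∃ σ : TetFace 1,
    ∃ q₁ ∈ (polyOn {0} ((k : ℤ) - 2) * polyOn {1} ((k : ℤ) - 1) :
      Submodule ℝ (MvPolynomial (Fin 2) ℝ)),
    ∃ q₂ ∈ (polyOn {0} ((k : ℤ) - 1) * polyOn {1} ((k : ℤ) - 2) :
      Submodule ℝ (MvPolynomial (Fin 2) ℝ)),
    M = fun E => vertInt σ fun y =>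
      (onVert E σ y ⬝ᵥ e4) * eval y q₁ + (-(onVert E σ y ⬝ᵥ unitTangent σ)) * eval y q₂}

/-- The 2 tetrahedral facets: `∫_F Tr E · q`, `q ∈ (P^{k-3}(F))³`. -/
def tetDofs (k : ℕ) : Set (Field4 → ℝ) :=
  {M | ∃ σ : TetFace 3, ∃ z : ℝ, (z = -1 ∨ z = 1) ∧
    ∃ q : Fin 3 → MvPolynomial (Fin 3) ℝ, (∀ i, q i ∈ polyOn Set.univ ((k : ℤ) - 3)) ∧
    M = fun E => horizInt σ fun s => onHoriz E σ z s ⬝ᵥ ∑ i, eval s (q i) • tangent σ i}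

/-- The 4 triangular-prismatic facets, moments of the first kind:
`∫_F Tr E · q`, `q ∈ Q^{k-2}(C¹) × [P^{k-2}(T²), P^{k-2}(T²), 0]ᵀ`. -/
def triPrismDofs₁ (k : ℕ) : Set (Field4 → ℝ) :=
  {M | ∃ σ : TetFace 2, ∃ q : Fin 2 → MvPolynomial (Fin 3) ℝ,
    (∀ i, q i ∈ vertPoly 2 ((k : ℤ) - 2) ((k : ℤ) - 2)) ∧
    M = fun E => vertInt σ fun y => onVert E σ y ⬝ᵥ ∑ i, eval y (q i) • tangent σ i}

/-- The 4 triangular-prismatic facets, moments of the second kind: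
`∫_F Tr E · q`, `q ∈ Q^{k-1}(C¹) × [0, 0, P^{k-3}(T²)]ᵀ`. -/
def triPrismDofs₂ (k : ℕ) : Set (Field4 → ℝ) :=
  {M | ∃ σ : TetFace 2, ∃ q ∈ vertPoly 2 ((k : ℤ) - 1) ((k : ℤ) - 3),
    M = fun E => vertInt σ fun y => onVert E σ y ⬝ᵥ (eval y q • e4)}

/-- All edge, face and facet degrees of freedom. -/
def traceDofs (k : ℕ) : Set (Field4 → ℝ) :=
  horizEdgeDofs k ∪ vertEdgeDofs k ∪ triangleDofs k ∪ quadDofs k ∪ tetDofs k ∪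
    triPrismDofs₁ k ∪ triPrismDofs₂ k

/-- First volume moments: `∫_{W⁴} E · Σ_r qʳ Φ^{b,r} ϑᵇ(x₄) [Nʳ, 0]ᵀ`,
`qʳ ∈ P^{k-2}(T¹) × P^{k-3}(T³)`. -/
def volDofs₁ (k : ℕ) : Set (Field4 → ℝ) :=
  {M | ∃ q : Fin 3 → Poly4, (∀ r, q r ∈ polyTensor ((k : ℤ) - 2) ((k : ℤ) - 3)) ∧
    M = fun E => ∫ x in prism,
      fieldAt E x ⬝ᵥ fieldAt (∑ r, (q r * phiB r * bubbleT1) • whitney r) x}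

/-- Second volume moments: `∫_{W⁴} E · [0, 0, 0, q ϑᵇ(x₁,x₂,x₃)]ᵀ`,
`q ∈ P^{k-1}(T¹) × P^{k-4}(T³)`. -/
def volDofs₂ (k : ℕ) : Set (Field4 → ℝ) :=
  {M | ∃ q ∈ polyTensor ((k : ℤ) - 1) ((k : ℤ) - 4),
    M = fun E => ∫ x in prism, fieldAt E x ⬝ᵥ fieldAt (Pi.single 3 (q * bubbleT3)) x}

/-- The degrees of freedom of 1-forms on the tetrahedral prism. -/
def oneFormDofs (k : ℕ) : Set (Field4 → ℝ) := traceDofs k ∪ (volDofs₁ k ∪ volDofs₂ k)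

end TetPrism

end

/-! The horizontal part (E₁, E₂, E₃) and the vertical component E₄ decouple. Membership in the space
enters only through degree bounds in two groups of variables, x₄ and (x₁, x₂, x₃): E₄ has degrees
(k-1, k), while the horizontal components have degrees (k, k) and, which is the Nédélec property, so
does x · E. This property passes to faces (`IsNedelec.pull_radial_mem`).

All vanishing results follow one scheme. Traces already known to vanish on the boundary of a face
make affine functions divide the restriction of the field. Dividing lowers the degree enough for the
quotient to lie in the test space of that face. A suitable choice of test function then turns the
moment into the integral of a sum of squares with nonnegative polynomial weights, so every square
with a nonzero weight vanishes. In negative degree the spaces are zero, so small k needs no separate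
treatment.

Horizontal part: on x₄ = ±1 the scheme runs through edges, triangles and the tetrahedron, so the
horizontal part vanishes there and equals ϑᵇ(x₄) F with F of degree k-2 in x₄
(`exists_bubbleT1_mul`). The factor ϑᵇ(x₄) ≥ 0 serves as a weight on the vertical faces, where the
quadrilateral and triangular-prism moments kill the tangential traces of F. A Nédélec field without
tangential traces on the four face planes is a combination of the Φʳ Nʳ with coefficients three
degrees lower (`IsNedelec.exists_bubble`).

Vertical component: E₄ behaves as a scalar Lagrange function; it vanishes on vertical edges,
quadrilaterals and triangular prisms in turn, hence is divisible by λ₁λ₂λ₃λ₄ (`exists_vert_bubble`).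

For the second claim, the coefficients found in this way are admissible in the volume moments, so E
can be tested against itself. -/

namespace TetPrism

/-! ## Degree in a set of variables -/

section DegreeIn

variable {ι κ : Type*}

open Classical in
/-- The degree of a monomial in the variables of `S`. -/
noncomputable def degIn (S : Set ι) : (ι →₀ ℕ) →+ ℕ :=
  Finsupp.degree.comp (Finsupp.filterAddHom (· ∈ S))

open Classical in
theorem degIn_apply (S : Set ι) (m : ι →₀ ℕ) : degIn S m = (m.filter (· ∈ S)).degree := rfl

open Classical in
theorem degIn_single (S : Set ι) (i : ι) (n : ℕ) :
    degIn S (Finsupp.single i n) = if i ∈ S then n else 0 := by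
  rw [degIn_apply]
  split_ifs with h
  · rw [Finsupp.filter_single_of_pos _ h, Finsupp.degree_single]
  · rw [Finsupp.filter_single_of_neg _ h, map_zero]

open Classical in
/-- The homomorphism that marks the variables in `S` by an additional variable. -/
noncomputable def markVars (S : Set ι) : MvPolynomial ι ℝ →ₐ[ℝ] Polynomial (MvPolynomial ι ℝ) :=
  aeval fun i => if i ∈ S then Polynomial.C (X i) * Polynomial.X else Polynomial.C (X i)

theorem markVars_monomial_one (S : Set ι) (m : ι →₀ ℕ) :
    markVars S (monomial m 1) = Polynomial.C (monomial m 1) * Polynomial.X ^ degIn S m := by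
  induction m using Finsupp.induction_linear with
  | zero => simp
  | add f g hf hg =>
    have h : (monomial (f + g) 1 : MvPolynomial ι ℝ) = monomial f 1 * monomial g 1 := by
      rw [monomial_mul, one_mul]
    rw [h, map_mul, hf, hg, map_mul, map_add]
    ring
  | single i n =>
    rw [degIn_single, ← X_pow_eq_monomial, map_pow, markVars, aeval_X]
    split_ifs
    · rw [mul_pow, map_pow]
    · simp

theorem markVars_monomial (S : Set ι) (m : ι →₀ ℕ) (a : ℝ) :
    markVars S (monomial m a) = Polynomial.C (monomial m a) * Polynomial.X ^ degIn S m := by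
  have h : (monomial m a : MvPolynomial ι ℝ) = a • monomial m 1 := by simp [smul_monomial]
  rw [h, map_smul, markVars_monomial_one, ← Polynomial.smul_C, smul_mul_assoc]

/-- Each monomial m goes to m tⁿ, n being its degree in `S`, so nothing cancels. Degree in `S`
becomes the degree in one variable t over a domain, which is additive under products; this is what
makes division lower degrees. -/
theorem coeff_coeff_markVars (S : Set ι) (p : MvPolynomial ι ℝ) (m : ι →₀ ℕ) :
    coeff m ((markVars S p).coeff (degIn S m)) = coeff m p := by
  classical
  induction p using MvPolynomial.induction_on' with
  | monomial n a =>
    rw [markVars_monomial, Polynomial.coeff_C_mul, Polynomial.coeff_X_pow]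
    split_ifs with h
    · rw [mul_one]
    · rw [mul_zero, coeff_zero, coeff_monomial, if_neg]
      rintro rfl
      exact h rfl
  | add p q hp hq => rw [map_add, Polynomial.coeff_add, coeff_add, hp, hq, coeff_add]

theorem markVars_injective (S : Set ι) : Function.Injective (markVars (ι := ι) S) := by
  rw [injective_iff_map_eq_zero]
  intro p hp
  ext m
  rw [← coeff_coeff_markVars S, hp]
  simp

/-- Polynomials of degree `≤ j` in the variables of `S`. -/
noncomputable def degLE (S : Set ι) (j : ℤ) : Submodule ℝ (MvPolynomial ι ℝ) :=
  restrictSupport ℝ {m | (degIn S m : ℤ) ≤ j}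

/-- The alternative `p = 0` matters for negative `j`: the space is then zero, but `natDegree 0 = 0`.
-/
theorem mem_degLE_iff {S : Set ι} {j : ℤ} {p : MvPolynomial ι ℝ} :
    p ∈ degLE S j ↔ p = 0 ∨ ((markVars S p).natDegree : ℤ) ≤ j := by
  rw [degLE, mem_restrictSupport_iff]
  constructor
  · intro h
    by_cases h0 : p = 0
    · exact Or.inl h0
    right
    have hj : 0 ≤ j := by
      obtain ⟨m, hm⟩ := (support_nonempty (p := p)).2 h0
      have := h hm
      simp only [Set.mem_ofPred_eq] at this
      omega
    lift j to ℕ using hj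
    norm_cast
    rw [← support_sum_monomial_coeff p, map_sum]
    refine Polynomial.natDegree_sum_le_of_forall_le _ _ fun m hm => ?_
    rw [markVars_monomial]
    refine (Polynomial.natDegree_C_mul_X_pow_le _ _).trans ?_
    exact_mod_cast h hm
  · rintro (rfl | h) m hm
    · simp at hm
    · refine le_trans ?_ h
      norm_cast
      refine Polynomial.le_natDegree_of_ne_zero fun h0 => ?_
      rw [Finset.mem_coe, mem_support_iff, ← coeff_coeff_markVars S, h0] at hm
      simp at hm

theorem degLE_mono (S : Set ι) {i j : ℤ} (h : i ≤ j) : degLE S i ≤ degLE S j :=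
  restrictSupport_mono _ fun _ hm => le_trans hm h

theorem mul_mem_degLE {S : Set ι} {i j : ℤ} {p q : MvPolynomial ι ℝ} (hp : p ∈ degLE S i)
    (hq : q ∈ degLE S j) : p * q ∈ degLE S (i + j) := by
  rw [mem_degLE_iff] at *
  rcases hp with rfl | hp
  · simp
  rcases hq with rfl | hq
  · simp
  right
  rw [map_mul]
  have := Polynomial.natDegree_mul_le (p := markVars S p) (q := markVars S q)
  omega

/-- Division by a polynomial of degree `n` lowers the degree by `n`. -/
theorem mem_degLE_of_mul {S : Set ι} {j n : ℤ} {l p : MvPolynomial ι ℝ} (h : l * p ∈ degLE S j)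
    (hl : l ∉ degLE S (n - 1)) : p ∈ degLE S (j - n) := by
  rw [mem_degLE_iff] at *
  push Not at hl
  by_cases hp : p = 0
  · exact Or.inl hp
  right
  have h1 := h.resolve_left (mul_ne_zero hl.1 hp)
  rw [map_mul, Polynomial.natDegree_mul ((map_ne_zero_iff _ (markVars_injective S)).2 hl.1)
    ((map_ne_zero_iff _ (markVars_injective S)).2 hp)] at h1
  have := hl.2
  push_cast at h1
  omega

theorem C_mem_degLE (S : Set ι) {j : ℤ} (hj : 0 ≤ j) (a : ℝ) :
    (C a : MvPolynomial ι ℝ) ∈ degLE S j := by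
  rw [mem_degLE_iff]
  right
  have : markVars S (C a : MvPolynomial ι ℝ) = Polynomial.C (C a) := by
    rw [markVars, aeval_C]
    rfl
  rw [this, Polynomial.natDegree_C]
  exact_mod_cast hj

theorem one_mem_degLE (S : Set ι) {j : ℤ} (hj : 0 ≤ j) : (1 : MvPolynomial ι ℝ) ∈ degLE S j := by
  simpa using C_mem_degLE S hj 1

theorem monomial_mem_degLE (S : Set ι) (m : ι →₀ ℕ) (a : ℝ) {j : ℤ} (h : (degIn S m : ℤ) ≤ j) :
    monomial m a ∈ degLE S j :=
  (monomial_mem_restrictSupport _).2 (Or.inl h)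

theorem X_mem_degLE (S : Set ι) {j : ℤ} (hj : 1 ≤ j) (i : ι) :
    (X i : MvPolynomial ι ℝ) ∈ degLE S j := by
  refine monomial_mem_degLE S _ _ ?_
  rw [degIn_single]
  split_ifs <;> simp <;> omega

theorem X_mem_degLE_of_notMem {S : Set ι} {j : ℤ} (hj : 0 ≤ j) {i : ι} (hi : i ∉ S) :
    (X i : MvPolynomial ι ℝ) ∈ degLE S j := by
  refine monomial_mem_degLE S _ _ ?_
  rw [degIn_single, if_neg hi]
  simpa using hj

/-- A polynomial with a nonzero coefficient of a variable in `S` is not of degree `0` in `S`. -/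
theorem notMem_degLE_zero {S : Set ι} {i : ι} (hi : i ∈ S) {l : MvPolynomial ι ℝ}
    (hl : coeff (Finsupp.single i 1) l ≠ 0) : l ∉ degLE S 0 := by
  intro h
  have := h (mem_support_iff.2 hl)
  simp only [Set.mem_ofPred_eq, degIn_single, if_pos hi] at this
  norm_num at this

theorem aeval_mem_degLE {S : Set ι} {T : Set κ} {φ : ι → MvPolynomial κ ℝ}
    (h1 : ∀ i ∈ S, φ i ∈ degLE T 1) (h0 : ∀ i ∉ S, φ i ∈ degLE T 0) {j : ℤ} {p : MvPolynomial ι ℝ}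
    (hp : p ∈ degLE S j) : aeval φ p ∈ degLE T j := by
  have key : ∀ m : ι →₀ ℕ, aeval φ (monomial m (1 : ℝ)) ∈ degLE T (degIn S m) := by
    intro m
    induction m using Finsupp.induction_linear with
    | zero => simpa using one_mem_degLE T le_rfl
    | add f g hf hg =>
      have h : (monomial (f + g) 1 : MvPolynomial ι ℝ) = monomial f 1 * monomial g 1 := by
        rw [monomial_mul, one_mul]
      rw [h, map_mul, map_add]
      exact_mod_cast mul_mem_degLE hf hg
    | single i n =>
      rw [← X_pow_eq_monomial, map_pow, aeval_X, degIn_single]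
      split_ifs with hi
      · induction n with
        | zero => simpa using one_mem_degLE T le_rfl
        | succ n ih =>
          rw [pow_succ]
          exact_mod_cast mul_mem_degLE ih (h1 i hi)
      · induction n with
        | zero => simpa using one_mem_degLE T le_rfl
        | succ n ih =>
          rw [pow_succ]
          simpa using mul_mem_degLE ih (h0 i hi)
  rw [← support_sum_monomial_coeff p, map_sum]
  refine Submodule.sum_mem _ fun m hm => ?_
  have h : (monomial m (coeff m p) : MvPolynomial ι ℝ) = coeff m p • monomial m 1 := by
    simp [smul_monomial]
  rw [h, map_smul]
  exact Submodule.smul_mem _ _ (degLE_mono T (hp hm) (key m))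

/-- Polynomials of degree `≤ i` in the variables outside `S` and `≤ j` in those of `S`. -/
noncomputable def biDegLE (S : Set ι) (i j : ℤ) : Submodule ℝ (MvPolynomial ι ℝ) :=
  degLE Sᶜ i ⊓ degLE S j

-- Exponent sets of a product space add, and every exponent splits uniquely into its parts inside
-- and outside `S`. The tensor product thus becomes a pair of independent degree conditions, which
-- can be followed through products, quotients and substitutions.
open Pointwise in
theorem polyOn_mul_polyOn (S : Set ι) (i j : ℤ) :
    polyOn Sᶜ i * polyOn S j = biDegLE S i j := by
  classical
  rw [polyOn, polyOn, ← restrictSupport_add]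
  ext p
  rw [biDegLE, Submodule.mem_inf, degLE, degLE]
  simp only [mem_restrictSupport_iff, ← Set.subset_inter_iff]
  have hdeg : ∀ (T : Set ι) (m : ι →₀ ℕ), (m.support : Set ι) ⊆ T → degIn T m = m.degree := by
    intro T m h
    rw [degIn_apply, (Finsupp.filter_eq_self_iff _ _).2]
    intro x hx
    exact h (by simpa using hx)
  have hdeg0 : ∀ (T : Set ι) (m : ι →₀ ℕ), (m.support : Set ι) ⊆ Tᶜ → degIn T m = 0 := by
    intro T m h
    rw [degIn_apply, (Finsupp.filter_eq_zero_iff _ _).2, map_zero]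
    intro x hx
    by_contra h0
    exact h (by simpa using h0) hx
  have : {m : ι →₀ ℕ | (m.support : Set ι) ⊆ Sᶜ ∧ (m.degree : ℤ) ≤ i} +
      {m : ι →₀ ℕ | (m.support : Set ι) ⊆ S ∧ (m.degree : ℤ) ≤ j} =
      {m | (degIn Sᶜ m : ℤ) ≤ i} ∩ {m | (degIn S m : ℤ) ≤ j} := by
    ext m
    constructor
    · rintro ⟨a, ⟨ha, ha'⟩, b, ⟨hb, hb'⟩, rfl⟩
      simp only [Set.mem_inter_iff, Set.mem_ofPred_eq, map_add]
      rw [hdeg _ a ha, hdeg _ b hb, hdeg0 _ a ha, hdeg0 _ b (by simpa using hb)]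
      simpa using ⟨ha', hb'⟩
    · rintro ⟨h1, h2⟩
      refine ⟨m.filter (· ∈ Sᶜ), ⟨?_, ?_⟩, m.filter (· ∈ S), ⟨?_, ?_⟩, ?_⟩
      · intro x hx
        simp at hx ⊢
        exact hx.2
      · rw [Set.mem_ofPred_eq, degIn_apply] at h1
        convert h1
      · intro x hx
        simp at hx ⊢
        exact hx.2
      · rw [Set.mem_ofPred_eq, degIn_apply] at h2
        convert h2
      · exact (add_comm _ _).trans (Finsupp.filter_add_filter_not m (· ∈ S))
  rw [this]

theorem polyOn_le_degLE (S T : Set ι) (j : ℤ) : polyOn S j ≤ degLE T j := by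
  classical
  refine restrictSupport_mono _ fun m hm => le_trans ?_ hm.2
  have : m.degree = (m.filter (· ∈ T)).degree + (m.filter (¬ · ∈ T)).degree := by
    rw [← map_add, Finsupp.filter_add_filter_not]
  rw [degIn_apply]
  omega

theorem polyOn_le_degLE_zero {S T : Set ι} (h : Disjoint S T) (j : ℤ) :
    polyOn S j ≤ degLE T 0 := by
  classical
  refine restrictSupport_mono _ fun m hm => ?_
  have : degIn T m = 0 := by
    rw [degIn_apply, (Finsupp.filter_eq_zero_iff _ _).2, map_zero]
    intro x hx
    by_contra h0
    exact Set.disjoint_left.1 h (hm.1 (by simpa using h0)) hx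
  simp [this]

theorem degLE_univ (j : ℤ) : degLE (Set.univ : Set ι) j = polyOn Set.univ j := by
  classical
  have : ∀ m : ι →₀ ℕ, m.filter (fun _ => True) = m := fun m => by ext; simp
  simp [degLE, polyOn, degIn_apply, this]

theorem polyOn_le_biDegLE {S : Set ι} (j : ℤ) : polyOn S j ≤ biDegLE S 0 j :=
  le_inf (polyOn_le_degLE_zero disjoint_compl_right j) (polyOn_le_degLE S S j)

theorem polyOn_compl_le_biDegLE {S : Set ι} (j : ℤ) : polyOn Sᶜ j ≤ biDegLE S j 0 :=
  le_inf (polyOn_le_degLE _ _ j) (polyOn_le_degLE_zero disjoint_compl_left j)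

theorem biDegLE_mono (S : Set ι) {i j i' j' : ℤ} (hi : i ≤ i') (hj : j ≤ j') :
    biDegLE S i j ≤ biDegLE S i' j' :=
  inf_le_inf (degLE_mono _ hi) (degLE_mono _ hj)

theorem mul_mem_biDegLE {S : Set ι} {i j i' j' : ℤ} {p q : MvPolynomial ι ℝ}
    (hp : p ∈ biDegLE S i j) (hq : q ∈ biDegLE S i' j') : p * q ∈ biDegLE S (i + i') (j + j') :=
  ⟨mul_mem_degLE hp.1 hq.1, mul_mem_degLE hp.2 hq.2⟩

theorem C_mul_mem_biDegLE {S : Set ι} {i j : ℤ} {p : MvPolynomial ι ℝ} (a : ℝ)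
    (hp : p ∈ biDegLE S i j) : C a * p ∈ biDegLE S i j := by
  rw [← smul_eq_C_mul]
  exact Submodule.smul_mem _ _ hp

/-- Products with affine functions of the variables in `S`. -/
theorem linear_mul_mem_biDegLE {S : Set ι} {i j : ℤ} {l p : MvPolynomial ι ℝ}
    (hl : l ∈ biDegLE S 0 1) (hp : p ∈ biDegLE S i (j - 1)) : l * p ∈ biDegLE S i j := by
  simpa using mul_mem_biDegLE hl hp

/-- Division by affine functions of the variables in `S`. -/
theorem mem_biDegLE_of_linear_mul {S : Set ι} {i j : ℤ} {l p : MvPolynomial ι ℝ}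
    (hl0 : l ≠ 0) (hl : l ∉ degLE S 0) (h : l * p ∈ biDegLE S i j) : p ∈ biDegLE S i (j - 1) := by
  refine ⟨?_, mem_degLE_of_mul h.2 (n := 1) hl⟩
  -- Degree at most -1 means zero, so this only says `l ≠ 0`; division by `l` then does not raise
  -- the degree in the other variables.
  have : l ∉ degLE Sᶜ (0 - 1) := by
    rw [mem_degLE_iff]
    push Not
    exact ⟨hl0, by omega⟩
  simpa using mem_degLE_of_mul h.1 this

/-- Division by affine functions of the variables outside `S`. -/
theorem mem_biDegLE_of_linear_mul_compl {S : Set ι} {i j : ℤ} {l p : MvPolynomial ι ℝ}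
    (hl0 : l ≠ 0) (hl : l ∉ degLE Sᶜ 0) (h : l * p ∈ biDegLE S i j) : p ∈ biDegLE S (i - 1) j := by
  have h' : l * p ∈ biDegLE Sᶜ j i := ⟨by rw [compl_compl]; exact h.2, h.1⟩
  have := mem_biDegLE_of_linear_mul hl0 hl h'
  rw [biDegLE, compl_compl] at this
  exact ⟨this.2, this.1⟩

theorem aeval_mem_biDegLE {S : Set ι} {T : Set κ} {φ : ι → MvPolynomial κ ℝ}
    (h1 : ∀ i ∈ S, φ i ∈ biDegLE T 0 1) (h0 : ∀ i ∉ S, φ i ∈ biDegLE T 1 0) {i j : ℤ}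
    {p : MvPolynomial ι ℝ} (hp : p ∈ biDegLE S i j) : aeval φ p ∈ biDegLE T i j :=
  ⟨aeval_mem_degLE (fun i hi => (h0 i hi).1) (fun i hi => (h1 i (not_not.1 hi)).1) hp.1,
    aeval_mem_degLE (fun i hi => (h1 i hi).2) (fun i hi => (h0 i hi).2) hp.2⟩

theorem X_mem_biDegLE {S : Set ι} {i : ι} (hi : i ∈ S) :
    (X i : MvPolynomial ι ℝ) ∈ biDegLE S 0 1 :=
  ⟨X_mem_degLE_of_notMem le_rfl (by simpa using hi), X_mem_degLE _ le_rfl i⟩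

theorem X_mem_biDegLE_compl {S : Set ι} {i : ι} (hi : i ∉ S) :
    (X i : MvPolynomial ι ℝ) ∈ biDegLE S 1 0 :=
  ⟨X_mem_degLE _ le_rfl i, X_mem_degLE_of_notMem le_rfl hi⟩

theorem C_mem_biDegLE {S : Set ι} {i j : ℤ} (hi : 0 ≤ i) (hj : 0 ≤ j) (a : ℝ) :
    (C a : MvPolynomial ι ℝ) ∈ biDegLE S i j :=
  ⟨C_mem_degLE _ hi a, C_mem_degLE _ hj a⟩

end DegreeIn

/-! ## Division by affine functions -/

theorem eval_aeval_apply {ι κ : Type*} (φ : ι → MvPolynomial κ ℝ) (y : κ → ℝ)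
    (p : MvPolynomial ι ℝ) : eval y (aeval φ p) = eval (fun m => eval y (φ m)) p := by
  induction p using MvPolynomial.induction_on with
  | C a => simp
  | add p q hp hq => rw [map_add, map_add, map_add, hp, hq]
  | mul_X p m hp => rw [map_mul, map_mul, map_mul, hp, aeval_X, eval_X]

section Affine

variable {ι : Type*} [DecidableEq ι]

/-- The substitution of `r` for the variable `i`. -/
noncomputable def substVar (i : ι) (r : MvPolynomial ι ℝ) :
    MvPolynomial ι ℝ →ₐ[ℝ] MvPolynomial ι ℝ :=
  aeval (Function.update X i r)

/-- Modulo `X i - r`, the substitution agrees with the identity on all variables. -/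
theorem dvd_sub_substVar (i : ι) (r p : MvPolynomial ι ℝ) : X i - r ∣ p - substVar i r p := by
  rw [← Ideal.mem_span_singleton, ← Ideal.Quotient.mk_eq_mk_iff_sub_mem]
  have : (Ideal.Quotient.mkₐ ℝ (Ideal.span {X i - r})) =
      (Ideal.Quotient.mkₐ ℝ (Ideal.span {X i - r})).comp (substVar i r) := by
    ext j
    by_cases h : j = i
    · subst h
      simp [substVar, Ideal.Quotient.mk_eq_mk_iff_sub_mem]
    · simp [substVar, h]
  exact congrArg (fun f => f p) this

/-- An affine function in the variable `i`: `a (x_i - r)`, where `r` does not involve `x_i`. -/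
structure IsAffine (i : ι) (l : MvPolynomial ι ℝ) : Prop where
  exists_eq : ∃ a : ℝ, a ≠ 0 ∧ ∃ r : MvPolynomial ι ℝ, substVar i r r = r ∧ l = C a * (X i - r)

/-- Solving l = 0 for the variable `i` gives a homomorphism with kernel (l), and evaluating its
image at a point amounts to evaluating `p` on the hyperplane. The first fact makes l prime, the
second makes divisibility by l the same as vanishing on the hyperplane. -/
theorem IsAffine.dvd_iff {i : ι} {l : MvPolynomial ι ℝ} (hl : IsAffine i l) :
    ∃ φ : MvPolynomial ι ℝ →ₐ[ℝ] MvPolynomial ι ℝ, (∀ p, l ∣ p ↔ φ p = 0) ∧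
      ∀ p, ∀ x, eval x (φ p) = 0 ∨ ∃ y, eval y l = 0 ∧ eval y p ≠ 0 := by
  obtain ⟨a, ha, r, hr, rfl⟩ := hl.exists_eq
  have hu : IsUnit (C a : MvPolynomial ι ℝ) := (IsUnit.mk0 a ha).map C
  have h0 : substVar i r (X i - r) = 0 := by
    rw [map_sub, hr]
    simp [substVar]
  refine ⟨substVar i r, fun p => ⟨?_, fun h => ?_⟩, fun p x => ?_⟩
  · rintro ⟨q, rfl⟩
    rw [map_mul, map_mul, h0]
    simp
  · rw [hu.mul_left_dvd]
    simpa [h] using dvd_sub_substVar i r p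
  · have he : ∀ q, eval x (substVar i r q) = eval (Function.update x i (eval x r)) q := by
      intro q
      rw [substVar, eval_aeval_apply]
      congr 2
      ext j
      by_cases h : j = i
      · subst h; simp
      · simp [h]
    by_contra! h
    refine h.1 ((he p).trans (h.2 _ ?_))
    rw [← he, map_mul, h0]
    simp

theorem IsAffine.dvd_of_eval_eq_zero {i : ι} {l p : MvPolynomial ι ℝ} (hl : IsAffine i l)
    (h : ∀ x, eval x l = 0 → eval x p = 0) : l ∣ p := by
  obtain ⟨φ, hφ, he⟩ := hl.dvd_iff
  rw [hφ]
  refine MvPolynomial.funext fun x => ?_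
  rw [map_zero]
  rcases he p x with h0 | ⟨y, h1, h2⟩
  · exact h0
  · exact absurd (h y h1) h2

theorem IsAffine.dvd_or_dvd {i : ι} {l p q : MvPolynomial ι ℝ} (hl : IsAffine i l)
    (h : l ∣ p * q) : l ∣ p ∨ l ∣ q := by
  obtain ⟨φ, hφ, -⟩ := hl.dvd_iff
  rw [hφ, map_mul] at h
  rw [hφ, hφ]
  exact mul_eq_zero.1 h

/-- If `l` and `m` divide `p`, `l` is affine and does not divide `m`, then `m l` divides `p`. -/
theorem IsAffine.mul_dvd {i : ι} {l m p : MvPolynomial ι ℝ} (hl : IsAffine i l)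
    (h : l ∣ p) (hm : m ∣ p) (x : ι → ℝ) (hx : eval x l = 0) (hx' : eval x m ≠ 0) : m * l ∣ p := by
  obtain ⟨q, rfl⟩ := hm
  refine mul_dvd_mul_left m ((hl.dvd_or_dvd h).resolve_left ?_)
  rintro ⟨r, rfl⟩
  simp [hx] at hx'

end Affine

/-! ## Integrals of nonnegative polynomials -/

section Positivity

variable {ι : Type*} [Fintype ι]

theorem eq_zero_of_eval_eq_zero {U : Set (ι → ℝ)} (hU : IsOpen U) (hne : U.Nonempty)
    {p : MvPolynomial ι ℝ} (h : ∀ x ∈ U, eval x p = 0) : p = 0 := by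
  obtain ⟨x, hx⟩ := hne
  obtain ⟨ε, hε, hb⟩ := Metric.isOpen_iff.1 hU x hx
  refine MvPolynomial.funext_set (fun i => Metric.ball (x i) ε) (fun i => ?_) fun y hy => ?_
  · rw [Real.ball_eq_Ioo]
    exact Set.Ioo_infinite (by linarith)
  · rw [map_zero]
    exact h y (hb (by rwa [ball_pi x hε]))

/-- A polynomial between `0` and a polynomial with integral `0` vanishes. -/
theorem eq_zero_of_integral_eq_zero {K : Set (ι → ℝ)} (hK : IsCompact K)
    (hne : (interior K).Nonempty) {p q : MvPolynomial ι ℝ}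
    (hp : ∀ x ∈ K, 0 ≤ eval x p ∧ eval x p ≤ eval x q) (h : ∫ x in K, eval x q = 0) : p = 0 := by
  have hint : IntegrableOn (fun x => eval x q) K :=
    (continuous_eval q).continuousOn.integrableOn_compact hK
  -- A nonnegative integrand with integral zero vanishes almost everywhere, hence by continuity on
  -- the whole interior, and a polynomial vanishing on a nonempty open set is zero.
  have hae := (setIntegral_eq_zero_iff_of_nonneg_ae
    ((ae_restrict_iff' hK.measurableSet).2 (.of_forall fun x hx => (hp x hx).1.trans (hp x hx).2))
    hint).1 h
  have h0 : Set.EqOn (fun x => eval x q) 0 (interior K) :=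
    Measure.eqOn_open_of_ae_eq (ae_restrict_of_ae_restrict_of_subset interior_subset hae)
      isOpen_interior (continuous_eval q).continuousOn continuousOn_const
  refine eq_zero_of_eval_eq_zero isOpen_interior hne fun x hx => ?_
  have h1 := hp x (interior_subset hx)
  have h2 := h0 hx
  simp only [Pi.zero_apply] at h2
  linarith

end Positivity

/-! ## Parameter domains -/

theorem simplexDom_subset (d : ℕ) : simplexDom d ⊆ Set.Icc 0 1 := by
  rintro s ⟨h0, h1⟩
  refine ⟨h0, fun i => ?_⟩
  exact (Finset.single_le_sum (fun j _ => h0 j) (Finset.mem_univ i)).trans h1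

theorem isClosed_simplexDom (d : ℕ) : IsClosed (simplexDom d) := by
  have : simplexDom d = (⋂ i, {s | 0 ≤ s i}) ∩ {s | ∑ i, s i ≤ 1} := by
    ext s
    simp [simplexDom]
  rw [this]
  refine (isClosed_iInter fun i => ?_).inter ?_
  · exact isClosed_le (by fun_prop) (by fun_prop)
  · exact isClosed_le (by fun_prop) (by fun_prop)

theorem isCompact_simplexDom (d : ℕ) : IsCompact (simplexDom d) :=
  isCompact_Icc.of_isClosed_subset (isClosed_simplexDom d) (simplexDom_subset d)

theorem interior_simplexDom_nonempty (d : ℕ) : (interior (simplexDom d)).Nonempty := by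
  have hd : (0 : ℝ) < d + 1 := by positivity
  refine ⟨fun _ => 1 / (d + 1), interior_maximal (t := (⋂ i, {s | 0 < s i}) ∩ {s | ∑ i, s i < 1})
    ?_ ?_ ?_⟩
  · rintro s ⟨h0, h1⟩
    simp only [Set.mem_iInter, Set.mem_ofPred_eq] at h0 h1
    exact ⟨fun i => (h0 i).le, h1.le⟩
  · refine (isOpen_iInter_of_finite fun i => ?_).inter ?_
    · exact isOpen_lt (by fun_prop) (by fun_prop)
    · exact isOpen_lt (by fun_prop) (by fun_prop)
  · refine ⟨?_, ?_⟩
    · simp only [Set.mem_iInter, Set.mem_ofPred_eq]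
      intro i
      positivity
    · simp only [Set.mem_ofPred_eq, Finset.sum_const, Finset.card_univ, Fintype.card_fin,
        nsmul_eq_mul]
      rw [mul_one_div, div_lt_one hd]
      linarith

theorem isCompact_prismDom (d : ℕ) : IsCompact (prismDom d) := by
  refine (isCompact_Icc (a := fun _ => (-1 : ℝ)) (b := fun _ => 1)).of_isClosed_subset ?_ ?_
  · have : prismDom d = Fin.init ⁻¹' simplexDom d ∩
        ({y | -1 ≤ y (Fin.last d)} ∩ {y | y (Fin.last d) ≤ 1}) := by
      ext s
      simp [prismDom]
    rw [this]
    refine ((isClosed_simplexDom d).preimage ?_).inter (.inter ?_ ?_)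
    · unfold Fin.init
      fun_prop
    · exact isClosed_le (by fun_prop) (by fun_prop)
    · exact isClosed_le (by fun_prop) (by fun_prop)
  · rintro y ⟨h, h1, h2⟩
    have h' := simplexDom_subset d h
    constructor <;> intro i <;> refine Fin.lastCases ?_ (fun j => ?_) i
    · exact h1
    · have := h'.1 j
      simp only [Pi.zero_apply, Fin.init] at this
      linarith
    · exact h2
    · exact h'.2 j

theorem interior_prismDom_nonempty (d : ℕ) : (interior (prismDom d)).Nonempty := by
  obtain ⟨s, hs⟩ := interior_simplexDom_nonempty d
  refine ⟨Fin.snoc s 0, interior_maximal (t := Fin.init ⁻¹' interior (simplexDom d) ∩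
    ({y | -1 < y (Fin.last d)} ∩ {y | y (Fin.last d) < 1})) ?_ ?_ ?_⟩
  · rintro y ⟨h, h1, h2⟩
    exact ⟨interior_subset h, le_of_lt h1, le_of_lt h2⟩
  · refine (isOpen_interior.preimage ?_).inter (.inter ?_ ?_)
    · unfold Fin.init
      fun_prop
    · exact isOpen_lt (by fun_prop) (by fun_prop)
    · exact isOpen_lt (by fun_prop) (by fun_prop)
  · refine ⟨?_, ?_, ?_⟩
    · rw [Set.mem_preimage, Fin.init_snoc]
      exact hs
    · simp
    · simp

theorem isCompact_prism : IsCompact prism := by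
  refine (isCompact_Icc (a := fun _ => (-1 : ℝ)) (b := fun _ => 1)).of_isClosed_subset ?_ ?_
  · have : prism = (⋂ i, {x | -1 ≤ x i} ∩ {x | x i ≤ 1}) ∩ {x | x 0 + x 1 + x 2 ≤ -1} := by
      ext s
      simp [prism]
    rw [this]
    refine (isClosed_iInter fun i => .inter ?_ ?_).inter ?_
    · exact isClosed_le (by fun_prop) (by fun_prop)
    · exact isClosed_le (by fun_prop) (by fun_prop)
    · exact isClosed_le (by fun_prop) (by fun_prop)
  · rintro x ⟨h, -⟩
    exact ⟨fun i => (h i).1, fun i => (h i).2⟩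

theorem interior_prism_nonempty : (interior prism).Nonempty := by
  refine ⟨fun _ => -1 / 2, interior_maximal
    (t := (⋂ i, {x | -1 < x i} ∩ {x | x i < 1}) ∩ {x | x 0 + x 1 + x 2 < -1}) ?_ ?_ ?_⟩
  · rintro x ⟨h, h1⟩
    simp only [Set.mem_iInter, Set.mem_inter_iff, Set.mem_ofPred_eq] at h h1
    exact ⟨fun i => ⟨(h i).1.le, (h i).2.le⟩, h1.le⟩
  · refine (isOpen_iInter_of_finite fun i => .inter ?_ ?_).inter ?_
    · exact isOpen_lt (by fun_prop) (by fun_prop)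
    · exact isOpen_lt (by fun_prop) (by fun_prop)
    · exact isOpen_lt (by fun_prop) (by fun_prop)
  · refine ⟨?_, ?_⟩
    · simp only [Set.mem_iInter, Set.mem_inter_iff, Set.mem_ofPred_eq]
      intro i
      norm_num
    · simp only [Set.mem_ofPred_eq]
      norm_num

/-! ## Faces of the tetrahedron -/

theorem eval_bary (x : Fin 4 → ℝ) (i : Fin 4) :
    eval x (bary i) = if i = 3 then -(x 0 + x 1 + x 2 + 1) / 2 else (x i + 1) / 2 := by
  unfold bary
  split_ifs <;> simp <;> ring

theorem eval_bary_vertex (i j : Fin 4) (z : ℝ) :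
    eval (vertex i z) (bary j) = if i = j then 1 else 0 := by
  rw [eval_bary]
  fin_cases i <;> fin_cases j <;> simp [vertex]

theorem tangent_three {d : ℕ} (σ : TetFace d) (i : Fin d) : tangent σ i 3 = 0 := by
  simp [tangent, vertex]

theorem vertex_apply {j : Fin 4} (hj : j ≠ 3) (i : Fin 4) (z w : ℝ) :
    vertex i z j = vertex i w j := by
  simp [vertex, hj]

theorem vertex_three (i : Fin 4) (z : ℝ) : vertex i z 3 = z := by
  simp [vertex]

theorem facePoint_three {d : ℕ} (σ : TetFace d) (s : Fin d → ℝ) (z : ℝ) :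
    facePoint σ s z 3 = z := by
  simp [facePoint, tangent_three, vertex_three]

/-- λ_j is affine, independent of the height, and is 1 at the vertex `j` and 0 at the others, so on
a face it interpolates these values. -/
theorem eval_bary_facePoint {d : ℕ} (σ : TetFace d) (s : Fin d → ℝ) (z : ℝ) (j : Fin 4) :
    eval (facePoint σ s z) (bary j) = (if σ 0 = j then 1 else 0) +
      ∑ i, s i * ((if σ i.succ = j then 1 else 0) - if σ 0 = j then 1 else 0) := by
  simp only [← eval_bary_vertex _ j 0]
  simp only [eval_bary]
  split_ifs with h
  · simp only [facePoint, tangent, Pi.add_apply, Finset.sum_apply, Pi.smul_apply, Pi.sub_apply,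
      smul_eq_mul]
    rw [vertex_apply (by decide) _ z 0, vertex_apply (j := 1) (by decide) _ z 0,
      vertex_apply (j := 2) (by decide) _ z 0]
    have : ∀ a b c e : ℝ, -(a + b + c + e) / 2 = -a / 2 + -b / 2 + -c / 2 + -e / 2 := by
      intros; ring
    have h1 : ∀ i, s i * (-(vertex (σ i.succ) 0 0 + vertex (σ i.succ) 0 1 +
        vertex (σ i.succ) 0 2 + 1) / 2 - -(vertex (σ 0) 0 0 + vertex (σ 0) 0 1 +
        vertex (σ 0) 0 2 + 1) / 2) = -(1 / 2) * (s i * (vertex (σ i.succ) 0 0 - vertex (σ 0) 0 0)) +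
        -(1 / 2) * (s i * (vertex (σ i.succ) 0 1 - vertex (σ 0) 0 1)) +
        -(1 / 2) * (s i * (vertex (σ i.succ) 0 2 - vertex (σ 0) 0 2)) := by
      intros; ring
    rw [Finset.sum_congr rfl fun i _ => h1 i, Finset.sum_add_distrib, Finset.sum_add_distrib,
      ← Finset.mul_sum, ← Finset.mul_sum, ← Finset.mul_sum]
    ring
  · simp only [facePoint, tangent, Pi.add_apply, Finset.sum_apply, Pi.smul_apply, Pi.sub_apply,
      smul_eq_mul]
    rw [vertex_apply h _ z 0]
    have h1 : ∀ i, s i * ((vertex (σ i.succ) 0 j + 1) / 2 - (vertex (σ 0) 0 j + 1) / 2) =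
        1 / 2 * (s i * (vertex (σ i.succ) 0 j - vertex (σ 0) 0 j)) := by
      intros; ring
    rw [Finset.sum_congr rfl fun i _ => h1 i, ← Finset.mul_sum]
    ring

theorem eval_bary_nonneg {d : ℕ} (σ : TetFace d) {s : Fin d → ℝ} (hs : s ∈ simplexDom d) (z : ℝ)
    (j : Fin 4) : 0 ≤ eval (facePoint σ s z) (bary j) := by
  rw [eval_bary_facePoint]
  by_cases h : σ 0 = j
  · have : ∀ i : Fin d, σ i.succ ≠ j := fun i hi =>
      Fin.succ_ne_zero i (σ.injective (hi.trans h.symm))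
    simp only [h, this, if_true, if_false, zero_sub, mul_neg, mul_one, Finset.sum_neg_distrib]
    linarith [hs.2]
  · simp only [h, if_false, sub_zero, zero_add]
    refine Finset.sum_nonneg fun i _ => mul_nonneg (hs.1 i) ?_
    split_ifs <;> norm_num

/-- The parameter sᵢ is the barycentric coordinate of the vertex `σ i.succ`, so it can be read off
from the point. -/
theorem tangent_combination_injective {d : ℕ} (σ : TetFace d) {s : Fin d → ℝ}
    (h : ∑ i, s i • tangent σ i = 0) : s = 0 := by
  ext i
  have h1 : eval (facePoint σ s 0) (bary (σ i.succ)) = eval (vertex (σ 0) 0) (bary (σ i.succ)) := by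
    rw [facePoint, h, add_zero]
  rw [eval_bary_facePoint, eval_bary_vertex] at h1
  simp only [EmbeddingLike.apply_eq_iff_eq, (Fin.succ_ne_zero i).symm, Fin.succ_inj] at h1
  simpa using h1

theorem faceJac_ne_zero {d : ℕ} (σ : TetFace d) : faceJac σ ≠ 0 := by
  have h : (Matrix.of (tangent σ) * (Matrix.of (tangent σ)).conjTranspose).PosDef := by
    refine Matrix.PosDef.mul_conjTranspose_self _ ?_
    intro s t hst
    rw [← sub_eq_zero]
    refine tangent_combination_injective σ ?_
    rw [← sub_eq_zero] at hst
    simp only [← Matrix.sub_vecMul] at hst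
    rw [← hst]
    ext j
    simp [Matrix.vecMul, dotProduct]
  refine (Real.sqrt_pos.2 ?_).ne'
  have e : (Matrix.of fun i j => tangent σ i ⬝ᵥ tangent σ j) =
      Matrix.of (tangent σ) * (Matrix.of (tangent σ)).conjTranspose := by
    ext i j
    simp [Matrix.mul_apply, dotProduct]
  rw [e]
  exact h.det_pos

theorem exists_unitTangent (σ : TetFace 1) : ∃ a : ℝ, a ≠ 0 ∧ unitTangent σ = a • tangent σ 0 := by
  refine ⟨_, inv_ne_zero ?_, rfl⟩
  have := faceJac_ne_zero σ
  rwa [faceJac, Matrix.det_fin_one] at this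

/-- The face opposite to the vertex number `j`. -/
def subface {d : ℕ} (σ : TetFace (d + 1)) (j : Fin (d + 2)) : TetFace d :=
  (Fin.succAboveOrderEmb j).trans σ

theorem subface_apply {d : ℕ} (σ : TetFace (d + 1)) (j : Fin (d + 2)) (i : Fin (d + 1)) :
    subface σ j i = σ (j.succAbove i) := rfl

theorem tangent_subface_succ {d : ℕ} (σ : TetFace (d + 1)) (j : Fin (d + 1)) (i : Fin d) :
    tangent (subface σ j.succ) i = tangent σ (j.succAbove i) := by
  rw [tangent, subface_apply, subface_apply, Fin.succ_succAbove_succ, Fin.succ_succAbove_zero,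
    tangent]

theorem tangent_subface_zero {d : ℕ} (σ : TetFace (d + 1)) (i : Fin d) :
    tangent (subface σ 0) i = tangent σ i.succ - tangent σ 0 := by
  simp [tangent, subface_apply]

theorem facePoint_subface_succ {d : ℕ} (σ : TetFace (d + 1)) (j : Fin (d + 1))
    {s : Fin (d + 1) → ℝ} (hs : s j = 0) (z : ℝ) :
    facePoint σ s z = facePoint (subface σ j.succ) (fun i => s (j.succAbove i)) z := by
  simp only [facePoint, tangent_subface_succ, subface_apply, Fin.succ_succAbove_zero]
  rw [Fin.sum_univ_succAbove _ j, hs, zero_smul, zero_add]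

/-- On the face opposite to the base vertex the base point becomes `σ 1`, and the first parameter is
eliminated through the condition that the parameters sum to 1. -/
theorem facePoint_subface_zero {d : ℕ} (σ : TetFace (d + 1))
    {s : Fin (d + 1) → ℝ} (hs : ∑ i, s i = 1) (z : ℝ) :
    facePoint σ s z = facePoint (subface σ 0) (fun i => s i.succ) z := by
  simp only [facePoint, tangent_subface_zero, subface_apply, Fin.zero_succAbove, smul_sub,
    Finset.sum_sub_distrib, ← Finset.sum_smul]
  rw [Fin.sum_univ_succ] at hs ⊢
  have h : vertex (σ (Fin.succ 0)) z = vertex (σ 0) z + tangent σ 0 := by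
    ext k
    by_cases hk : k = 3
    · simp [hk, vertex, tangent]
    · simp only [Pi.add_apply, tangent, Pi.sub_apply, vertex_apply hk _ z 0]
      ring
  rw [h, eq_sub_iff_add_eq.2 hs]
  module

/-- A point on the hyperplane `λ_j = 0` is a point of the facet opposite to the vertex `j`. -/
theorem exists_facePoint_of_bary_eq_zero {x : Fin 4 → ℝ} {j : Fin 4} (h : eval x (bary j) = 0) :
    ∃ s, x = facePoint (subface (RelEmbedding.refl _) j : TetFace 2) s (x 3) := by
  refine ⟨fun i => eval x (bary (j.succAbove i.succ)), ?_⟩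
  simp only [eval_bary] at h ⊢
  ext i
  fin_cases j <;> fin_cases i <;>
    simp [facePoint, tangent, subface_apply, vertex, Fin.sum_univ_two, Fin.succAbove,
      Fin.lt_def] at h ⊢ <;> linarith

/-- Every point is a point of the tetrahedron's affine hull at its height. -/
theorem exists_facePoint (x : Fin 4 → ℝ) :
    ∃ s, x = facePoint (RelEmbedding.refl _ : TetFace 3) s (x 3) := by
  refine ⟨fun i => eval x (bary i.succ), ?_⟩
  simp only [eval_bary]
  ext i
  fin_cases i <;>
    simp [facePoint, tangent, vertex, Fin.sum_univ_succ, Fin.ext_iff] <;> linarith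

/-! ## Vanishing of polynomials with vanishing moments -/

section Moments

variable {ι : Type*} {S : Set ι} {i j : ℤ}

theorem ne_zero_of_notMem {p : MvPolynomial ι ℝ} {V : Submodule ℝ (MvPolynomial ι ℝ)}
    (h : p ∉ V) : p ≠ 0 := by
  rintro rfl
  exact h V.zero_mem

theorem X_notMem_degLE_zero {a : ι} (ha : a ∈ S) : (X a : MvPolynomial ι ℝ) ∉ degLE S 0 := by
  classical exact notMem_degLE_zero ha (by simp [coeff_X])

theorem coeff_single_one (a : ι) : coeff (Finsupp.single a 1) (1 : MvPolynomial ι ℝ) = 0 := by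
  classical rw [coeff_one, if_neg (Finsupp.single_ne_zero.2 one_ne_zero).symm]

theorem one_sub_X_notMem_degLE_zero {a : ι} (ha : a ∈ S) :
    (1 - X a : MvPolynomial ι ℝ) ∉ degLE S 0 := by
  classical exact notMem_degLE_zero ha (by simp [coeff_X, coeff_single_one])

theorem one_sub_X_sub_X_notMem_degLE_zero {a b : ι} (h : a ≠ b) (ha : a ∈ S) :
    (1 - X a - X b : MvPolynomial ι ℝ) ∉ degLE S 0 := by
  classical
  exact notMem_degLE_zero ha (by simp [coeff_X, coeff_single_one, Finsupp.single_left_inj, h.symm])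

theorem isAffine_X [DecidableEq ι] (a : ι) : IsAffine a (X a : MvPolynomial ι ℝ) :=
  ⟨1, one_ne_zero, 0, by simp, by simp⟩

theorem isAffine_one_sub_X [DecidableEq ι] (a : ι) : IsAffine a (1 - X a : MvPolynomial ι ℝ) :=
  ⟨-1, by norm_num, 1, by simp, by simp⟩

theorem isAffine_one_sub_X_sub_X [DecidableEq ι] {a b : ι} (h : a ≠ b) :
    IsAffine a (1 - X a - X b : MvPolynomial ι ℝ) :=
  ⟨-1, by norm_num, 1 - X b, by simp [substVar, h.symm], by simp; ring⟩

variable [Fintype ι] {K : Set (ι → ℝ)} {w : MvPolynomial ι ℝ}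

/-- If a sum of squares with nonnegative weights has integral `0`, all its terms vanish. -/
theorem eq_zero_of_integral_sum_sq {κ : Type*} [Fintype κ] (hK : IsCompact K)
    (hne : (interior K).Nonempty) {b g : κ → MvPolynomial ι ℝ}
    (hb : ∀ m, ∀ x ∈ K, 0 ≤ eval x (b m)) (h : ∫ x in K, eval x (∑ m, b m * g m ^ 2) = 0) {m : κ}
    (hm : b m ≠ 0) : g m = 0 := by
  have key : ∀ x ∈ K, ∀ n, 0 ≤ eval x (b n * g n ^ 2) := by
    intro x hx n
    rw [map_mul, map_pow]
    exact mul_nonneg (hb n x hx) (sq_nonneg _)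
  have := eq_zero_of_integral_eq_zero hK hne (p := b m * g m ^ 2) (fun x hx => by
    refine ⟨key x hx m, ?_⟩
    rw [map_sum]
    exact Finset.single_le_sum (f := fun n => eval x (b n * g n ^ 2)) (fun n _ => key x hx n)
      (Finset.mem_univ m)) h
  simpa [hm] using this

/-- A polynomial all of whose weighted moments vanish is `0`. -/
theorem eq_zero_of_moments (hK : IsCompact K) (hne : (interior K).Nonempty)
    (hw : ∀ x ∈ K, 0 ≤ eval x w) (hw0 : w ≠ 0) {V : Submodule ℝ (MvPolynomial ι ℝ)}
    {f : MvPolynomial ι ℝ} (hf : f ∈ V)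
    (h : ∀ q ∈ V, ∫ x in K, eval x (w * (f * q)) = 0) : f = 0 := by
  refine eq_zero_of_integral_sum_sq hK hne (κ := Unit) (b := fun _ => w) (g := fun _ => f)
    (fun _ => hw) ?_ (m := ()) hw0
  simpa [sq] using h f hf

/-- A polynomial `b f` with `b ≥ 0` whose moments against a space containing `f` vanish is `0`. -/
theorem eq_zero_of_bubble_moments (hK : IsCompact K) (hne : (interior K).Nonempty)
    {b f : MvPolynomial ι ℝ} (hb : ∀ x ∈ K, 0 ≤ eval x b)
    {V : Submodule ℝ (MvPolynomial ι ℝ)} (hf : f ∈ V)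
    (h : ∀ q ∈ V, ∫ x in K, eval x (b * f * q) = 0) : b * f = 0 := by
  by_cases hb0 : b = 0
  · rw [hb0, zero_mul]
  rw [eq_zero_of_moments hK hne hb hb0 hf fun q hq => by rw [← mul_assoc]; exact h q hq, mul_zero]

/-- A function on a segment that vanishes at both ends and has vanishing moments. -/
theorem eq_zero_of_edge_moments [DecidableEq ι] (hK : IsCompact K)
    (hne : (interior K).Nonempty) {a : ι}
    (ha : a ∈ S) (hK0 : ∀ x ∈ K, 0 ≤ x a ∧ x a ≤ 1) {f : MvPolynomial ι ℝ}
    (hf : f ∈ biDegLE S i j) (h0 : X a ∣ f) (h1 : 1 - X a ∣ f)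
    (h : ∀ q ∈ biDegLE S i (j - 2), ∫ x in K, eval x (f * q) = 0) : f = 0 := by
  obtain ⟨g, rfl⟩ : X a * (1 - X a) ∣ f := by
    refine (isAffine_one_sub_X a).mul_dvd h1 h0 (fun _ => 1) ?_ ?_ <;> simp
  refine eq_zero_of_bubble_moments hK hne (fun x hx => ?_) (V := biDegLE S i (j - 2)) ?_ h
  · have := hK0 x hx
    simp only [map_mul, map_sub, map_one, eval_X]
    exact mul_nonneg this.1 (by linarith)
  · rw [mul_assoc] at hf
    have := mem_biDegLE_of_linear_mul (ne_zero_of_notMem (X_notMem_degLE_zero ha))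
      (X_notMem_degLE_zero ha) hf
    have := mem_biDegLE_of_linear_mul (ne_zero_of_notMem (one_sub_X_notMem_degLE_zero ha))
      (one_sub_X_notMem_degLE_zero ha) this
    convert this using 2
    ring

/-- A function on a triangle that vanishes on the edges and has vanishing moments. -/
theorem eq_zero_of_face_moments [DecidableEq ι] (hK : IsCompact K)
    (hne : (interior K).Nonempty) {a b : ι} (hab : a ≠ b) (ha : a ∈ S) (hb : b ∈ S)
    (hK0 : ∀ x ∈ K, 0 ≤ x a ∧ 0 ≤ x b ∧ x a + x b ≤ 1) {f : MvPolynomial ι ℝ}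
    (hf : f ∈ biDegLE S i j) (h0 : X a ∣ f) (h1 : X b ∣ f) (h2 : 1 - X a - X b ∣ f)
    (h : ∀ q ∈ biDegLE S i (j - 3), ∫ x in K, eval x (f * q) = 0) : f = 0 := by
  have h01 : X a * X b ∣ f :=
    -- The point, here and below, lies on the hyperplane of the new factor and off those of the
    -- earlier ones, so the new factor is prime to their product.
    (isAffine_X b).mul_dvd h1 h0 (Function.update 1 b 0) (by simp) (by simp [hab])
  obtain ⟨g, rfl⟩ : X a * X b * (1 - X a - X b) ∣ f := by
    refine (isAffine_one_sub_X_sub_X hab).mul_dvd h2 h01 (fun _ => 1 / 2) ?_ ?_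
    · simp; norm_num
    · simp
  refine eq_zero_of_bubble_moments hK hne (fun x hx => ?_) (V := biDegLE S i (j - 3)) ?_ h
  · have := hK0 x hx
    simp only [map_mul, map_sub, map_one, eval_X]
    exact mul_nonneg (mul_nonneg this.1 this.2.1) (by linarith)
  · rw [mul_assoc, mul_assoc] at hf
    have := mem_biDegLE_of_linear_mul (ne_zero_of_notMem (X_notMem_degLE_zero ha))
      (X_notMem_degLE_zero ha) hf
    have := mem_biDegLE_of_linear_mul (ne_zero_of_notMem (X_notMem_degLE_zero hb))
      (X_notMem_degLE_zero hb) this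
    have := mem_biDegLE_of_linear_mul
      (ne_zero_of_notMem (one_sub_X_sub_X_notMem_degLE_zero hab ha))
      (one_sub_X_sub_X_notMem_degLE_zero hab ha) this
    convert this using 2
    ring

/-- Unisolvence of the interior moments of a Nédélec field on a triangle: `f₁` and `f₂` are the
components along the two edges that issue from the origin. -/
theorem eq_zero_of_triangle_moments (hK : IsCompact K) (hne : (interior K).Nonempty) {a b : ι}
    (hab : a ≠ b) (ha : a ∈ S) (hb : b ∈ S)
    (hK0 : ∀ x ∈ K, 0 ≤ x a ∧ 0 ≤ x b ∧ x a + x b ≤ 1)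
    (hw : ∀ x ∈ K, 0 ≤ eval x w) (hw0 : w ≠ 0) {f₁ f₂ : MvPolynomial ι ℝ}
    (hf₁ : f₁ ∈ biDegLE S i j) (hf : X a * f₁ + X b * f₂ ∈ biDegLE S i j)
    (h₁ : X b ∣ f₁) (h₂ : X a ∣ f₂) (h₃ : 1 - X a - X b ∣ f₁ - f₂)
    (h : ∀ q₁ ∈ biDegLE S i (j - 2), ∀ q₂ ∈ biDegLE S i (j - 2),
      ∫ x in K, eval x (w * (f₁ * q₁ + f₂ * q₂)) = 0) : f₁ = 0 ∧ f₂ = 0 := by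
  have hXa := X_notMem_degLE_zero ha
  have hXb := X_notMem_degLE_zero hb
  have hX := one_sub_X_sub_X_notMem_degLE_zero hab ha
  obtain ⟨p, rfl⟩ := h₁
  obtain ⟨r, rfl⟩ := h₂
  obtain ⟨t, ht⟩ := h₃
  have hp := mem_biDegLE_of_linear_mul (ne_zero_of_notMem hXb) hXb hf₁
  -- The radial condition gains a degree: `p` alone is only known to have degree `j - 1`.
  have hs : p + r ∈ biDegLE S i (j - 2) := by
    have e : X a * (X b * p) + X b * (X a * r) = X a * (X b * (p + r)) := by ring
    rw [e] at hf
    have := mem_biDegLE_of_linear_mul (ne_zero_of_notMem hXb) hXb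
      (mem_biDegLE_of_linear_mul (ne_zero_of_notMem hXa) hXa hf)
    convert this using 2
    ring
  -- The quotient g = -p - t and s = p + r, both of degree `j - 2`, are the natural coefficients: f₁
  -- = x_b (x_a s - λ g) and f₂ = x_a (s - x_a s + λ g) with λ = 1 - x_a - x_b.
  have hg : (1 - X a - X b) * (-p - t) = X a * (p + r) - p := by linear_combination ht
  have hgm : -p - t ∈ biDegLE S i (j - 2) := by
    have : (1 - X a - X b) * (-p - t) ∈ biDegLE S i (j - 1) := by
      rw [hg]
      refine sub_mem (linear_mul_mem_biDegLE (X_mem_biDegLE ha) ?_) hp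
      convert hs using 2
      ring
    have := mem_biDegLE_of_linear_mul (ne_zero_of_notMem hX) hX this
    convert this using 2
    ring
  generalize hg1 : -p - t = g at hg hgm
  generalize hs1 : p + r = s at hs hg
  have hpe : p = X a * s - (1 - X a - X b) * g := by linear_combination hg
  have hre : r = s - p := by linear_combination hs1
  -- Testing with (-g, g + s) yields the three edge bubbles times the squares of g + s, g and s.
  have e : X b * p * (-g) + X a * r * (g + s) = (1 - X a - X b) * X a * (g + s) ^ 2 +
      (1 - X a - X b) * X b * g ^ 2 + X a * X b * s ^ 2 := by
    rw [hre, hpe]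
    ring
  have hint := h (-g) (neg_mem hgm) (g + s) (add_mem hgm hs)
  have hnn : ∀ m, ∀ x ∈ K, 0 ≤ eval x ((![w * ((1 - X a - X b) * X a),
      w * ((1 - X a - X b) * X b), w * (X a * X b)] : Fin 3 → MvPolynomial ι ℝ) m) := by
    intro m x hx
    obtain ⟨h1, h2, h3⟩ := hK0 x hx
    have hwx := hw x hx
    have h4 : 0 ≤ 1 - x a - x b := by linarith
    fin_cases m <;> simp <;> positivity
  have hint' : ∫ x in K, eval x (∑ m, (![w * ((1 - X a - X b) * X a),
      w * ((1 - X a - X b) * X b), w * (X a * X b)] : Fin 3 → MvPolynomial ι ℝ) m *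
      (![g + s, g, s] : Fin 3 → MvPolynomial ι ℝ) m ^ 2) = 0 := by
    rw [← hint, e]
    refine integral_congr_ae (.of_forall fun x => congrArg (eval x) ?_)
    simp only [Fin.sum_univ_three, Matrix.cons_val]
    ring
  have hg0' : g = 0 := eq_zero_of_integral_sum_sq hK hne hnn hint' (m := 1)
    (mul_ne_zero hw0 (mul_ne_zero (ne_zero_of_notMem hX) (ne_zero_of_notMem hXb)))
  have hs0' : s = 0 := eq_zero_of_integral_sum_sq hK hne hnn hint' (m := 2)
    (mul_ne_zero hw0 (mul_ne_zero (ne_zero_of_notMem hXa) (ne_zero_of_notMem hXb)))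
  have hp0 : p = 0 := by rw [hpe, hs0', hg0']; ring
  rw [hre, hp0, hs0']
  simp

end Moments

/-! ## Restriction of polynomial fields to faces -/

/-- Polynomials of degree `≤ i` in `x₄` and of degree `≤ j` in `x₁, x₂, x₃`. -/
noncomputable abbrev prismPoly (i j : ℤ) : Submodule ℝ Poly4 := biDegLE {0, 1, 2} i j

theorem polyTensor_eq (i j : ℤ) : polyTensor i j = prismPoly i j := by
  rw [prismPoly, ← polyOn_mul_polyOn, polyTensor, polyT1, polyT3]
  congr 2
  ext m
  fin_cases m <;> simp

/-- The component of a field in a constant direction. -/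
noncomputable def component (E : Field4) (t : Fin 4 → ℝ) : Poly4 := ∑ m, C (t m) * E m

theorem eval_component (E : Field4) (t x : Fin 4 → ℝ) :
    eval x (component E t) = fieldAt E x ⬝ᵥ t := by
  simp [component, fieldAt, dotProduct, mul_comm]

theorem component_of_three {t : Fin 4 → ℝ} (ht : t 3 = 0) (E : Field4) :
    component E t = C (t 0) * E 0 + C (t 1) * E 1 + C (t 2) * E 2 := by
  simp [component, Fin.sum_univ_four, ht]

/-- Nédélec fields on the tetrahedron with coefficients of degree `≤ i` in `x₄`: the horizontal
components of `F` and of `x · F` are of degree `≤ j` in `x₁, x₂, x₃`. -/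
structure IsNedelec (i j : ℤ) (F : Field4) : Prop where
  mem : ∀ m, m ≠ 3 → F m ∈ prismPoly i j
  radial : X 0 * F 0 + X 1 * F 1 + X 2 * F 2 ∈ prismPoly i j

section Pull

variable {ι : Type*} {S : Set ι} {d : ℕ} (σ : TetFace d) (c : Fin d → ι) (h : MvPolynomial ι ℝ)

/-- Restriction of a polynomial to a face: the parameters are the variables `c i`, and `h` is the
height. -/
noncomputable def pull : Poly4 →ₐ[ℝ] MvPolynomial ι ℝ :=
  aeval fun m => C (vertex (σ 0) 0 m) + ∑ i, C (tangent σ i m) * X (c i) + if m = 3 then h else 0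

theorem eval_pull (y : ι → ℝ) (p : Poly4) :
    eval y (pull σ c h p) = eval (facePoint σ (fun i => y (c i)) (eval y h)) p := by
  rw [pull, eval_aeval_apply]
  congr 2
  ext m
  by_cases hm : m = 3
  · subst hm
    rw [facePoint_three]
    simp [tangent_three, vertex_three]
  · simp [hm, facePoint, vertex_apply hm _ (eval y h) 0, mul_comm]

variable {σ c h} {i j : ℤ}

theorem pull_mem (hc : ∀ n, c n ∈ S) (hh : h ∈ biDegLE S 1 0) {p : Poly4} (hp : p ∈ prismPoly i j) :
    pull σ c h p ∈ biDegLE S i j := by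
  refine aeval_mem_biDegLE (fun m hm => ?_) (fun m hm => ?_) hp
  · have h3 : m ≠ 3 := by
      rintro rfl
      simp at hm
    rw [if_neg h3, add_zero]
    refine add_mem (C_mem_biDegLE le_rfl zero_le_one _) (sum_mem fun n _ => ?_)
    exact C_mul_mem_biDegLE _ (X_mem_biDegLE (hc n))
  · have h3 : m = 3 := by
      fin_cases m <;> simp at hm ⊢
    subst h3
    simpa [tangent_three, vertex_three] using hh

theorem IsNedelec.component_mem {F : Field4} (hF : IsNedelec i j F) {t : Fin 4 → ℝ} (ht : t 3 = 0) :
    component F t ∈ prismPoly i j := by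
  rw [component_of_three ht]
  exact add_mem (add_mem (C_mul_mem_biDegLE _ (hF.mem 0 (by decide)))
    (C_mul_mem_biDegLE _ (hF.mem 1 (by decide)))) (C_mul_mem_biDegLE _ (hF.mem 2 (by decide)))

/-- A point of the face is x = v₀ + Σ sₙ tₙ, up to its height, so Σ sₙ (F · tₙ) = x · F - v₀ · F in
the horizontal components. Both terms satisfy the degree bound, so the restriction is again a
Nédélec field in the face parameters. -/
theorem IsNedelec.pull_radial_mem {F : Field4} (hF : IsNedelec i j F) (hc : ∀ n, c n ∈ S)
    (hh : h ∈ biDegLE S 1 0) :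
    ∑ n, X (c n) * pull σ c h (component F (tangent σ n)) ∈ biDegLE S i j := by
  have hX : ∀ m : Fin 4, m ≠ 3 → pull σ c h (X m) =
      C (vertex (σ 0) 0 m) + ∑ n, C (tangent σ n m) * X (c n) := by
    intro m hm
    rw [pull, aeval_X, if_neg hm, add_zero]
  have e : ∑ n, X (c n) * pull σ c h (component F (tangent σ n)) =
      pull σ c h (X 0 * F 0 + X 1 * F 1 + X 2 * F 2) -
      pull σ c h (component F (vertex (σ 0) 0)) := by
    rw [component_of_three (vertex_three _ _)]
    have h1 : ∀ n, X (c n) * pull σ c h (component F (tangent σ n)) =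
        C (tangent σ n 0) * X (c n) * pull σ c h (F 0) +
        C (tangent σ n 1) * X (c n) * pull σ c h (F 1) +
        C (tangent σ n 2) * X (c n) * pull σ c h (F 2) := by
      intro n
      rw [component_of_three (tangent_three _ _)]
      simp only [map_add, map_mul, ← algebraMap_eq, AlgHom.commutes]
      ring
    rw [Finset.sum_congr rfl fun n _ => h1 n, Finset.sum_add_distrib, Finset.sum_add_distrib,
      ← Finset.sum_mul, ← Finset.sum_mul, ← Finset.sum_mul]
    simp only [map_add, map_mul]
    rw [hX 0 (by decide), hX 1 (by decide), hX 2 (by decide)]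
    simp only [← algebraMap_eq, AlgHom.commutes]
    ring
  rw [e]
  exact sub_mem (pull_mem hc hh hF.radial) (pull_mem hc hh (hF.component_mem (vertex_three _ _)))

variable [Fintype ι] {K : Set (ι → ℝ)} {w : MvPolynomial ι ℝ}

/-- Unisolvence of the moments of a Nédélec field on an edge. -/
theorem IsNedelec.pull_edge_eq_zero {F : Field4} (hF : IsNedelec i j F) {σ : TetFace 1}
    {c : Fin 1 → ι} (hc : ∀ n, c n ∈ S) (hh : h ∈ biDegLE S 1 0) (hK : IsCompact K)
    (hne : (interior K).Nonempty) (hw : ∀ x ∈ K, 0 ≤ eval x w) (hw0 : w ≠ 0)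
    (hmom : ∀ q ∈ biDegLE S i (j - 1),
      ∫ x in K, eval x (w * (pull σ c h (component F (tangent σ 0)) * q)) = 0) :
    pull σ c h (component F (tangent σ 0)) = 0 := by
  have hr := hF.pull_radial_mem (σ := σ) hc hh
  rw [Fin.sum_univ_one] at hr
  have hX := X_notMem_degLE_zero (hc 0)
  -- On an edge the radial condition says that s (F · t) has degree at most `j`; hence F · t has
  -- degree at most `j - 1` and is its own test function.
  exact eq_zero_of_moments hK hne hw hw0
    (mem_biDegLE_of_linear_mul (ne_zero_of_notMem hX) hX hr) hmom

/-- Unisolvence of the moments of a Nédélec field on a triangle. -/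
theorem IsNedelec.pull_triangle_eq_zero [DecidableEq ι] {F : Field4} (hF : IsNedelec i j F)
    {σ : TetFace 2} {c : Fin 2 → ι} (hci : Function.Injective c) (hc : ∀ n, c n ∈ S)
    (hh : h ∈ biDegLE S 1 0) (hK : IsCompact K) (hne : (interior K).Nonempty)
    (hK0 : ∀ x ∈ K, (fun n => x (c n)) ∈ simplexDom 2) (hw : ∀ x ∈ K, 0 ≤ eval x w) (hw0 : w ≠ 0)
    (hedge : ∀ (e : TetFace 1) (s : Fin 1 → ℝ) (y : ι → ℝ),
      eval (facePoint e s (eval y h)) (component F (tangent e 0)) = 0)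
    (hmom : ∀ q : Fin 2 → MvPolynomial ι ℝ, (∀ n, q n ∈ biDegLE S i (j - 2)) →
      ∫ x in K, eval x (w * ∑ n, pull σ c h (component F (tangent σ n)) * q n) = 0) (n : Fin 2) :
    pull σ c h (component F (tangent σ n)) = 0 := by
  have hab : c 0 ≠ c 1 := fun h01 => absurd (hci h01) (by decide)
  have hr := hF.pull_radial_mem (σ := σ) hc hh
  rw [Fin.sum_univ_two] at hr
  have key := eq_zero_of_triangle_moments hK hne hab (hc 0) (hc 1) (fun x hx => by
      have := hK0 x hx
      have h2 := this.2
      rw [Fin.sum_univ_two] at h2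
      exact ⟨this.1 0, this.1 1, h2⟩) hw hw0
    (pull_mem hc hh (hF.component_mem (tangent_three σ 0))) hr ?_ ?_ ?_ (fun q₁ h₁ q₂ h₂ => by
      have := hmom ![q₁, q₂] (fun n => by fin_cases n; exacts [h₁, h₂])
      simpa [Fin.sum_univ_two] using this)
  · fin_cases n
    exacts [key.1, key.2]
  · refine (isAffine_X (c 1)).dvd_of_eval_eq_zero fun x hx => ?_
    rw [eval_X] at hx
    rw [eval_pull, facePoint_subface_succ σ 1 hx]
    exact (tangent_subface_succ σ 1 0) ▸ hedge (subface σ (Fin.succ 1)) _ x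
  · refine (isAffine_X (c 0)).dvd_of_eval_eq_zero fun x hx => ?_
    rw [eval_X] at hx
    rw [eval_pull, facePoint_subface_succ σ 0 hx]
    exact (tangent_subface_succ σ 0 0) ▸ hedge (subface σ (Fin.succ 0)) _ x
  · refine (isAffine_one_sub_X_sub_X hab).dvd_of_eval_eq_zero fun x hx => ?_
    simp only [map_sub, map_one, eval_X] at hx
    have hs : ∑ n, x (c n) = 1 := by
      rw [Fin.sum_univ_two]
      linarith
    rw [← map_sub, eval_pull, facePoint_subface_zero σ hs]
    -- The edge opposite to the base vertex has direction t₁ - t₀, so its trace is the difference of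
    -- the two components.
    have := hedge (subface σ 0) (fun n => x (c n.succ)) x
    rw [tangent_subface_zero, eval_component, dotProduct_sub, ← eval_component,
      ← eval_component] at this
    rw [map_sub]
    have h2 := neg_eq_zero.2 this
    rw [neg_sub] at h2
    exact h2

end Pull

/-! ## Nédélec fields with vanishing tangential traces -/

section Decomposition

theorem isAffine_bary (j : Fin 4) : IsAffine (if j = 3 then 0 else j) (bary j) := by
  by_cases h : j = 3
  · subst h
    exact ⟨-1 / 2, by norm_num, -X 1 - X 2 - 1, by simp [substVar], by simp [bary]; ring⟩
  · rw [if_neg h]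
    exact ⟨1 / 2, by norm_num, -1, by simp, by simp [bary, h]⟩

theorem bary_mem (j : Fin 4) : bary j ∈ prismPoly 0 1 := by
  have h1 : (1 : Poly4) ∈ prismPoly 0 1 := by
    simpa using C_mem_biDegLE (S := ({0, 1, 2} : Set (Fin 4))) le_rfl zero_le_one (1 : ℝ)
  unfold bary
  split_ifs with h
  · exact C_mul_mem_biDegLE _ (add_mem (add_mem (add_mem (X_mem_biDegLE (by simp))
      (X_mem_biDegLE (by simp))) (X_mem_biDegLE (by simp))) h1)
  · refine C_mul_mem_biDegLE _ (add_mem (X_mem_biDegLE ?_) h1)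
    fin_cases j <;> simp at h ⊢

theorem bary_notMem (j : Fin 4) : bary j ∉ degLE {0, 1, 2} 0 := by
  refine notMem_degLE_zero (i := if j = 3 then 0 else j) ?_ ?_
  · fin_cases j <;> simp
  · unfold bary
    split_ifs with h
    · simp [coeff_C_mul, coeff_X, coeff_single_one, Finsupp.single_left_inj]
    · simp [coeff_C_mul, coeff_X, coeff_single_one]

theorem bary_ne_zero (j : Fin 4) : bary j ≠ 0 := ne_zero_of_notMem (bary_notMem j)

theorem sum_bary : bary 0 + bary 1 + bary 2 + bary 3 = 1 := by
  refine MvPolynomial.funext fun x => ?_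
  simp [eval_bary]
  ring

theorem mem_of_bary_mul {i j : ℤ} {n : Fin 4} {p : Poly4} (h : bary n * p ∈ prismPoly i j) :
    p ∈ prismPoly i (j - 1) :=
  mem_biDegLE_of_linear_mul (bary_ne_zero n) (bary_notMem n) h

/-- If `λ_a` and `λ_b` divide `p`, so does their product. -/
theorem bary_mul_bary_dvd {a b : Fin 4} (hab : a ≠ b) {p : Poly4} (ha : bary a ∣ p)
    (hb : bary b ∣ p) : bary a * bary b ∣ p :=
  (isAffine_bary b).mul_dvd hb ha (vertex a 0) (by simp [eval_bary_vertex, hab])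
    (by simp [eval_bary_vertex])

/-- λ_a is prime and does not divide λ_b, which is 1 at the vertex `b` where λ_a is 0. -/
theorem bary_dvd_of_dvd_mul {a b : Fin 4} (hab : a ≠ b) {p : Poly4} (h : bary a ∣ bary b * p) :
    bary a ∣ p := by
  refine ((isAffine_bary a).dvd_or_dvd h).resolve_left ?_
  rintro ⟨r, hr⟩
  have := congrArg (eval (vertex b 0)) hr
  simp [eval_bary_vertex, hab.symm] at this

theorem grad_bary (j m : Fin 4) : grad (bary j) m =
    if m = 3 then 0 else if j = 3 then -C (1 / 2) else if m = j then C (1 / 2) else 0 := by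
  have h1 : ∀ m n : Fin 4, pderiv m (X n : Poly4) = if m = n then 1 else 0 := by
    intro m n
    rw [pderiv_X, Pi.single_apply]
    simp [eq_comm]
  have h2 : (C (-1 / 2) : Poly4) = -C (1 / 2) := by
    rw [← map_neg]
    norm_num
  unfold grad bary
  fin_cases j <;> fin_cases m <;> simp [h1, h2]

theorem whitney_three (r : Fin 3) : whitney r 3 = 0 := by
  simp [whitney, grad_bary]

/-- A Nédélec field with vanishing tangential traces is a combination of the fields `Φʳ Nʳ`. -/
theorem IsNedelec.exists_bubble {i j : ℤ} {F : Field4} (hF : IsNedelec i j F)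
    (h : ∀ (σ : TetFace 2) s z n, eval (facePoint σ s z) (component F (tangent σ n)) = 0) :
    ∃ g : Fin 3 → Poly4, (∀ r, g r ∈ prismPoly i (j - 3)) ∧
      ∀ m, m ≠ 3 → F m = ∑ r, g r * phiB r * whitney r m := by
  -- On the plane λ_n = 0 the tangential trace vanishes, so F has the same product with the position
  -- vectors of all vertices of that face.
  have key : ∀ a b n : Fin 4, a ≠ n → b ≠ n →
      ∀ x, eval x (bary n) = 0 → fieldAt F x ⬝ᵥ vertex a 0 = fieldAt F x ⬝ᵥ vertex b 0 := by
    have key' : ∀ n, ∀ m : Fin 3, ∀ x, eval x (bary n) = 0 →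
        fieldAt F x ⬝ᵥ vertex (n.succAbove m) 0 = fieldAt F x ⬝ᵥ vertex (n.succAbove 0) 0 := by
      intro n m x hx
      refine Fin.cases rfl (fun m => ?_) m
      obtain ⟨s, hs⟩ := exists_facePoint_of_bary_eq_zero hx
      have := h (subface (RelEmbedding.refl _) n) s (x 3) m
      rw [← hs, eval_component, tangent, dotProduct_sub, sub_eq_zero] at this
      exact this
    intro a b n ha hb x hx
    obtain ⟨a, rfl⟩ := Fin.exists_succAbove_eq ha
    obtain ⟨b, rfl⟩ := Fin.exists_succAbove_eq hb
    rw [key' n a x hx, key' n b x hx]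
  -- The edge from vertex 3 to vertex m has direction 2 e_m and lies in the face opposite to n.
  have dvd1 : ∀ m n : Fin 4, m ≠ 3 → n ≠ 3 → m ≠ n → bary n ∣ F m := by
    intro m n hm hn hmn
    refine (isAffine_bary n).dvd_of_eval_eq_zero fun x hx => ?_
    have := key m 3 n hmn hn.symm x hx
    rw [← sub_eq_zero, ← dotProduct_sub] at this
    have e : vertex m 0 - vertex 3 0 = Pi.single m 2 := by
      ext l
      by_cases hl : l = 3
      · subst hl
        simp [vertex, hm.symm]
      · by_cases hlm : l = m
        · subst hlm
          simp [vertex, hl]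
          norm_num
        · simp [vertex, hl, hlm]
    rw [e, dotProduct_single] at this
    simpa [fieldAt] using this
  have dvd2 : ∀ m n : Fin 4, m ≠ 3 → n ≠ 3 → bary 3 ∣ F m - F n := by
    intro m n hm hn
    refine (isAffine_bary 3).dvd_of_eval_eq_zero fun x hx => ?_
    have := key m n 3 hm hn x hx
    rw [← sub_eq_zero, ← dotProduct_sub] at this
    have e : vertex m 0 - vertex n 0 = Pi.single m 2 - Pi.single n 2 := by
      ext l
      by_cases hl : l = 3
      · subst hl
        simp [vertex, hm.symm, hn.symm]
      · simp only [vertex, hl, if_false, Pi.sub_apply, Pi.single_apply]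
        split_ifs <;> norm_num
    rw [e, dotProduct_sub, dotProduct_single, dotProduct_single] at this
    rw [map_sub]
    simp only [fieldAt] at this
    linarith
  obtain ⟨a0, h0⟩ := bary_mul_bary_dvd (by decide) (dvd1 0 1 (by decide) (by decide) (by decide))
    (dvd1 0 2 (by decide) (by decide) (by decide))
  obtain ⟨a1, h1⟩ := bary_mul_bary_dvd (by decide) (dvd1 1 0 (by decide) (by decide) (by decide))
    (dvd1 1 2 (by decide) (by decide) (by decide))
  obtain ⟨a2, h2⟩ := bary_mul_bary_dvd (by decide) (dvd1 2 0 (by decide) (by decide) (by decide))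
    (dvd1 2 1 (by decide) (by decide) (by decide))
  -- F₀ - F₁ = λ₂ (λ₁ a₀ - λ₀ a₁) is divisible by λ₃, which is prime to λ₂; likewise for the other
  -- two pairs.
  obtain ⟨u, hu⟩ : bary 3 ∣ bary 1 * a0 - bary 0 * a1 := by
    refine bary_dvd_of_dvd_mul (b := 2) (by decide) ?_
    convert dvd2 0 1 (by decide) (by decide) using 1
    rw [h0, h1]
    ring
  obtain ⟨v, hv⟩ : bary 3 ∣ bary 2 * a0 - bary 0 * a2 := by
    refine bary_dvd_of_dvd_mul (b := 1) (by decide) ?_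
    convert dvd2 0 2 (by decide) (by decide) using 1
    rw [h0, h2]
    ring
  obtain ⟨w, hw⟩ : bary 3 ∣ bary 2 * a1 - bary 1 * a2 := by
    refine bary_dvd_of_dvd_mul (b := 0) (by decide) ?_
    convert dvd2 1 2 (by decide) (by decide) using 1
    rw [h1, h2]
    ring
  have hsum := sum_bary
  have m0 : a0 ∈ prismPoly i (j - 2) := by
    have := hF.mem 0 (by decide)
    rw [h0, mul_assoc] at this
    convert mem_of_bary_mul (mem_of_bary_mul this) using 2
    ring
  have m2 : a2 ∈ prismPoly i (j - 2) := by
    have := hF.mem 2 (by decide)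
    rw [h2, mul_assoc] at this
    convert mem_of_bary_mul (mem_of_bary_mul this) using 2
    ring
  -- λ₀λ₁λ₂ (a₀ + a₁ + a₂) = Σ λ_m F_m = (x · F + Σ F_m)/2, with sums over m = 0, 1, 2. By the
  -- radial condition this has degree `j` rather than `j + 1`, so the sum of the a's has degree `j -
  -- 3`.
  have ms : a0 + a1 + a2 ∈ prismPoly i (j - 3) := by
    have : bary 0 * (bary 1 * (bary 2 * (a0 + a1 + a2))) ∈ prismPoly i j := by
      have e : bary 0 * (bary 1 * (bary 2 * (a0 + a1 + a2))) =
          C (1 / 2) * (X 0 * F 0 + X 1 * F 1 + X 2 * F 2) + C (1 / 2) * (F 0 + F 1 + F 2) := by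
        have : bary 0 * (bary 1 * (bary 2 * (a0 + a1 + a2))) =
            bary 0 * F 0 + bary 1 * F 1 + bary 2 * F 2 := by
          rw [h0, h1, h2]
          ring
        rw [this]
        simp only [bary, show (0 : Fin 4) ≠ 3 by decide, show (1 : Fin 4) ≠ 3 by decide,
          show (2 : Fin 4) ≠ 3 by decide, if_false]
        ring
      rw [e]
      exact add_mem (C_mul_mem_biDegLE _ hF.radial) (C_mul_mem_biDegLE _ (add_mem (add_mem
        (hF.mem 0 (by decide)) (hF.mem 1 (by decide))) (hF.mem 2 (by decide))))
    convert mem_of_bary_mul (mem_of_bary_mul (mem_of_bary_mul this)) using 2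
    ring
  have two_mem : ∀ {l p}, p ∈ prismPoly i l → 2 * p ∈ prismPoly i l := by
    intro l p hp
    rw [two_mul]
    exact add_mem hp hp
  have step : ∀ {p}, p ∈ prismPoly i (j - 3) → ∀ n, bary n * p ∈ prismPoly i (j - 2) := by
    intro p hp n
    refine linear_mul_mem_biDegLE (bary_mem n) ?_
    convert hp using 2
    ring
  -- The coefficients are forced. With F = Σ gᵣ Φʳ Nʳ, adding the a's gives g₂ = -2 (a₀ + a₁ + a₂);
  -- then F₀ determines λ₃ g₀ and F₂ determines λ₃ g₁. The quotients u, v, w carry out the division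
  -- by λ₃, which also brings the degree down to `j - 3`.
  have e0 : bary 3 * (-2 * (a0 + u + v)) = 2 * (bary 0 * (a0 + a1 + a2)) - 2 * a0 := by
    linear_combination 2 * hu + 2 * hv - 2 * a0 * hsum
  have e1 : bary 3 * (-2 * (v + w + a0 + a1)) =
      2 * a2 - 2 * (bary 2 * (a0 + a1 + a2) + bary 3 * (a0 + a1 + a2)) := by
    linear_combination 2 * hv + 2 * hw + 2 * a2 * hsum
  have m0' : -2 * (a0 + u + v) ∈ prismPoly i (j - 3) := by
    have : bary 3 * (-2 * (a0 + u + v)) ∈ prismPoly i (j - 2) := by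
      rw [e0]
      exact sub_mem (two_mem (step ms 0)) (two_mem m0)
    convert mem_of_bary_mul this using 2
    ring
  have m1' : -2 * (v + w + a0 + a1) ∈ prismPoly i (j - 3) := by
    have : bary 3 * (-2 * (v + w + a0 + a1)) ∈ prismPoly i (j - 2) := by
      rw [e1]
      exact sub_mem (two_mem m2) (two_mem (add_mem (step ms 2) (step ms 3)))
    convert mem_of_bary_mul this using 2
    ring
  have hc : (2 : Poly4) * C (1 / 2) = 1 := by
    have : (2 : Poly4) = C 2 := rfl
    rw [this, ← map_mul]
    norm_num
  refine ⟨![-2 * (a0 + u + v), -2 * (v + w + a0 + a1), -2 * (a0 + a1 + a2)], fun r => ?_,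
    fun m hm => ?_⟩
  · fin_cases r
    · exact m0'
    · exact m1'
    · have := neg_mem (two_mem ms)
      rwa [← neg_mul] at this
  · generalize -2 * (a0 + u + v) = g0 at e0
    generalize -2 * (v + w + a0 + a1) = g1 at e1
    have hm' : m = 0 ∨ m = 1 ∨ m = 2 := by
      fin_cases m <;> simp at hm ⊢
    have c0 : (Fin.castSucc 0 : Fin 4) = 0 := rfl
    have c1 : (Fin.castSucc 1 : Fin 4) = 1 := rfl
    have c2 : (Fin.castSucc 2 : Fin 4) = 2 := rfl
    simp only [Fin.sum_univ_three, Matrix.cons_val, phiB, whitney, Pi.sub_apply, Pi.smul_apply,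
      smul_eq_mul, grad_bary, c0, c1, c2, show (0 + 1 : Fin 4) = 1 by rfl,
      show (0 + 2 : Fin 4) = 2 by rfl, show (0 + 3 : Fin 4) = 3 by rfl,
      show (1 + 1 : Fin 4) = 2 by rfl, show (1 + 2 : Fin 4) = 3 by rfl,
      show (1 + 3 : Fin 4) = 0 by rfl, show (2 + 1 : Fin 4) = 3 by rfl,
      show (2 + 2 : Fin 4) = 0 by rfl, show (2 + 3 : Fin 4) = 1 by rfl]
    generalize (C (1 / 2) : Poly4) = c at hc
    rcases hm' with rfl | rfl | rfl
    · simp [h0]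
      linear_combination c * bary 1 * bary 2 * e0 - bary 1 * bary 2 * a0 * hc
    · simp [h1]
      linear_combination -c * bary 0 * bary 2 * e0 + c * bary 0 * bary 2 * e1 -
        2 * c * bary 0 * bary 2 * (a0 + a1 + a2) * hsum - bary 0 * bary 2 * a1 * hc
    · simp [h2]
      linear_combination -c * bary 0 * bary 1 * e1 - bary 0 * bary 1 * a2 * hc

end Decomposition

/-! ## Fields on a horizontal facet -/

section Height

variable {i j : ℤ}

theorem eval_substVar_three (z : ℝ) (x : Fin 4 → ℝ) (p : Poly4) :
    eval x (substVar 3 (C z) p) = eval (Function.update x 3 z) p := by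
  rw [substVar, eval_aeval_apply]
  congr 2
  ext m
  by_cases hm : m = 3
  · subst hm; simp
  · simp [hm]

theorem substVar_three_mem (z : ℝ) {p : Poly4} (hp : p ∈ prismPoly i j) :
    substVar 3 (C z) p ∈ prismPoly i j := by
  refine aeval_mem_biDegLE (fun m hm => ?_) (fun m hm => ?_) hp
  · have h3 : m ≠ 3 := by
      rintro rfl
      simp at hm
    rw [Function.update_of_ne h3]
    exact X_mem_biDegLE hm
  · have h3 : m = 3 := by
      fin_cases m <;> simp at hm ⊢
    subst h3
    rw [Function.update_self]
    exact C_mem_biDegLE zero_le_one le_rfl z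

theorem IsNedelec.substVar_three {F : Field4} (hF : IsNedelec i j F) (z : ℝ) :
    IsNedelec i j fun m => substVar 3 (C z) (F m) := by
  refine ⟨fun m hm => substVar_three_mem z (hF.mem m hm), ?_⟩
  have := substVar_three_mem z hF.radial
  simpa [substVar] using this

theorem component_substVar (F : Field4) (t : Fin 4 → ℝ) (z : ℝ) :
    component (fun m => substVar 3 (C z) (F m)) t = substVar 3 (C z) (component F t) := by
  simp only [component, map_sum, map_mul, ← algebraMap_eq, AlgHom.commutes]

theorem pull_substVar {d : ℕ} (σ : TetFace d) {ι : Type*} (c : Fin d → ι) (z : ℝ) (p : Poly4) :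
    pull σ c (C z) (substVar 3 (C z) p) = pull σ c (C z) p := by
  refine MvPolynomial.funext fun y => ?_
  rw [eval_pull, eval_pull, eval_substVar_three, eval_C]
  congr 2
  rw [Function.update_eq_self_iff, facePoint_three]

/-- The edge moments with weights `gʳ` of a bubble field form a sum of squares. -/
theorem bubble_pairing {F : Field4} {g : Fin 3 → Poly4}
    (hF : ∀ m, m ≠ 3 → F m = ∑ r, g r * phiB r * whitney r m) :
    component F (tangent (RelEmbedding.refl _ : TetFace 3) 0) * (g 0 - g 1) +
    component F (tangent (RelEmbedding.refl _ : TetFace 3) 1) * (g 1 - g 2) +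
    component F (tangent (RelEmbedding.refl _ : TetFace 3) 2) * g 2 =
    ∑ m, (![bary 0 * bary 2 * bary 3, bary 1 * bary 2 * bary 3, bary 0 * bary 1 * bary 3,
      bary 0 * bary 1 * bary 2] : Fin 4 → Poly4) m *
      (![g 0 - g 1, g 0, g 1 - g 2, g 2] : Fin 4 → Poly4) m ^ 2 := by
  have hc : (2 : Poly4) * C (1 / 2) = 1 := by
    have : (2 : Poly4) = C 2 := rfl
    rw [this, ← map_mul]
    norm_num
  have h2 : (C 2 : Poly4) = 2 := rfl
  have c0 : (Fin.castSucc 0 : Fin 4) = 0 := rfl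
  have c1 : (Fin.castSucc 1 : Fin 4) = 1 := rfl
  have c2 : (Fin.castSucc 2 : Fin 4) = 2 := rfl
  have t0 : ∀ n m, tangent (RelEmbedding.refl _ : TetFace 3) n m =
      if m = 3 then 0 else if m = 0 then -2 else if m = n.succ then 2 else 0 := by
    intro n m
    fin_cases n <;> fin_cases m <;> simp [tangent, vertex] <;> norm_num
  rw [component_of_three (tangent_three _ _), component_of_three (tangent_three _ _),
    component_of_three (tangent_three _ _), hF 0 (by decide), hF 1 (by decide), hF 2 (by decide)]
  simp only [t0, Fin.sum_univ_three, Fin.sum_univ_four, Matrix.cons_val, phiB, whitney,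
    Pi.sub_apply, Pi.smul_apply, smul_eq_mul, grad_bary, c0, c1, c2,
    show (0 + 1 : Fin 4) = 1 by rfl, show (0 + 2 : Fin 4) = 2 by rfl, show (0 + 3 : Fin 4) = 3 by rfl,
    show (1 + 1 : Fin 4) = 2 by rfl, show (1 + 2 : Fin 4) = 3 by rfl,
    show (1 + 3 : Fin 4) = 0 by rfl, show (2 + 1 : Fin 4) = 3 by rfl,
    show (2 + 2 : Fin 4) = 0 by rfl, show (2 + 3 : Fin 4) = 1 by rfl,
    show (Fin.succ 0 : Fin 4) = 1 by rfl, show (Fin.succ 1 : Fin 4) = 2 by rfl,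
    show (Fin.succ 2 : Fin 4) = 3 by rfl]
  generalize (C (1 / 2) : Poly4) = c at hc
  simp [h2]
  linear_combination (bary 0 * bary 2 * bary 3 * (g 0 - g 1) ^ 2 +
    bary 1 * bary 2 * bary 3 * g 0 ^ 2 + bary 0 * bary 1 * bary 3 * (g 1 - g 2) ^ 2 +
    bary 0 * bary 1 * bary 2 * g 2 ^ 2) * hc

/-- All four barycentric coordinates are 1/4 at the centroid. -/
theorem pull_bary_ne_zero (z : ℝ) (m : Fin 4) :
    pull (RelEmbedding.refl _ : TetFace 3) id (C z) (bary m) ≠ 0 := by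
  intro h0
  have := congrArg (eval fun _ => 1 / 4) h0
  rw [eval_pull, eval_bary_facePoint, Fin.sum_univ_three] at this
  fin_cases m <;> simp [Fin.ext_iff] at this
  norm_num at this

/-- Unisolvence of the interior moments of a Nédélec field on a tetrahedron. -/
theorem IsNedelec.eval_eq_zero_of_height {F : Field4} (hF : IsNedelec i j F) {z : ℝ}
    (htri : ∀ (σ : TetFace 2) s n, eval (facePoint σ s z) (component F (tangent σ n)) = 0)
    (hmom : ∀ q : Fin 3 → MvPolynomial (Fin 3) ℝ, (∀ n, q n ∈ biDegLE Set.univ i (j - 3)) →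
      ∫ s in simplexDom 3, eval s (∑ n, pull (RelEmbedding.refl _ : TetFace 3) id (C z)
        (component F (tangent (RelEmbedding.refl _ : TetFace 3) n)) * q n) = 0)
    (x : Fin 4 → ℝ) (hx : x 3 = z) (m : Fin 4) (hm : m ≠ 3) : eval x (F m) = 0 := by
  -- Freezing x₄ = z extends the vanishing traces from one height to all heights, as the bubble
  -- decomposition requires.
  obtain ⟨g, hg, hgF⟩ := (hF.substVar_three z).exists_bubble (fun σ s y n => by
    rw [component_substVar, eval_substVar_three]
    have : Function.update (facePoint σ s y) 3 z = facePoint σ s z := by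
      ext l
      by_cases hl : l = 3
      · subst hl
        rw [Function.update_self, facePoint_three]
      · simp [hl, facePoint, vertex_apply hl _ y z]
    rw [this]
    exact htri σ s n)
  set P := pull (RelEmbedding.refl _ : TetFace 3) id (C z)
  have hPg : ∀ r, P (g r) ∈ biDegLE Set.univ i (j - 3) := fun r =>
    pull_mem (fun _ => Set.mem_univ _) (C_mem_biDegLE zero_le_one le_rfl z) (hg r)
  -- In terms of the edge vectors from v₀ these are the coefficients of Σ gᵣ (v_{r+1} - v_r), the
  -- test field along the edges that carry the Nʳ.
  have hint := hmom ![P (g 0) - P (g 1), P (g 1) - P (g 2), P (g 2)] (fun n => by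
    fin_cases n
    exacts [sub_mem (hPg 0) (hPg 1), sub_mem (hPg 1) (hPg 2), hPg 2])
  have hsq : ∑ n, P (component F (tangent (RelEmbedding.refl _ : TetFace 3) n)) *
      (![P (g 0) - P (g 1), P (g 1) - P (g 2), P (g 2)] : Fin 3 → _) n =
      ∑ m, P ((![bary 0 * bary 2 * bary 3, bary 1 * bary 2 * bary 3, bary 0 * bary 1 * bary 3,
        bary 0 * bary 1 * bary 2] : Fin 4 → Poly4) m) *
        P ((![g 0 - g 1, g 0, g 1 - g 2, g 2] : Fin 4 → Poly4) m) ^ 2 := by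
    have := congrArg P (bubble_pairing hgF)
    simp only [map_add, map_mul, map_sub, component_substVar, map_sum, map_pow] at this
    rw [← this, Fin.sum_univ_three]
    simp only [P, pull_substVar, Matrix.cons_val]
  rw [hsq] at hint
  have hnn : ∀ m, ∀ s ∈ simplexDom 3, 0 ≤ eval s (P ((![bary 0 * bary 2 * bary 3,
      bary 1 * bary 2 * bary 3, bary 0 * bary 1 * bary 3, bary 0 * bary 1 * bary 2] :
      Fin 4 → Poly4) m)) := by
    intro m s hs
    have h0 : ∀ n, 0 ≤ eval s (P (bary n)) := fun n => by
      rw [eval_pull, eval_C]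
      exact eval_bary_nonneg _ hs z n
    fin_cases m <;> simp only [Matrix.cons_val, Fin.zero_eta, Fin.mk_one, Fin.reduceFinMk,
      map_mul] <;> exact mul_nonneg (mul_nonneg (h0 _) (h0 _)) (h0 _)
  have hz : ∀ n, P ((![g 0 - g 1, g 0, g 1 - g 2, g 2] : Fin 4 → Poly4) n) = 0 := fun n =>
    eq_zero_of_integral_sum_sq (isCompact_simplexDom 3) (interior_simplexDom_nonempty 3) hnn hint
      (by
        fin_cases n <;> simp only [Matrix.cons_val, Fin.zero_eta, Fin.mk_one, Fin.reduceFinMk,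
          map_mul] <;> simp [P, pull_bary_ne_zero])
  have z0 := hz 1
  have z1 := hz 0
  have z2 := hz 3
  simp only [Matrix.cons_val] at z0 z1 z2
  rw [map_sub, z0, zero_sub, neg_eq_zero] at z1
  have hgr : ∀ r, P (g r) = 0 := by
    intro r
    obtain rfl | rfl | rfl : r = 0 ∨ r = 1 ∨ r = 2 := by
      fin_cases r <;> simp
    exacts [z0, z1, z2]
  have hPF : P (F m) = 0 := by
    rw [← pull_substVar, hgF m hm, map_sum]
    refine Finset.sum_eq_zero fun r _ => ?_
    rw [map_mul, map_mul]
    have := hgr r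
    simp only [P] at this
    rw [this, zero_mul, zero_mul]
  obtain ⟨s, hs⟩ := exists_facePoint x
  have := congrArg (eval s) hPF
  rw [eval_pull, eval_C, map_zero] at this
  rw [hs, hx]
  exact this

end Height

/-! ## The space of 1-forms -/

/-- Nédélec fields with vanishing fourth component. -/
noncomputable def nedelecSpace (i j : ℤ) : Submodule ℝ Field4 where
  carrier := {F | IsNedelec i j F ∧ F 3 = 0}
  zero_mem' := ⟨⟨fun _ _ => zero_mem _, by simp⟩, rfl⟩
  add_mem' := by
    rintro F G ⟨hF, hF3⟩ ⟨hG, hG3⟩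
    refine ⟨⟨fun m hm => add_mem (hF.mem m hm) (hG.mem m hm), ?_⟩, by simp [hF3, hG3]⟩
    convert add_mem hF.radial hG.radial using 1
    simp only [Pi.add_apply]
    ring
  smul_mem' := by
    rintro a F ⟨hF, hF3⟩
    refine ⟨⟨fun m hm => Submodule.smul_mem _ a (hF.mem m hm), ?_⟩, by simp [hF3]⟩
    convert Submodule.smul_mem _ a hF.radial using 1
    simp only [Pi.smul_apply, smul_add, mul_smul_comm]

theorem polyT3_le (j : ℤ) : polyT3 j ≤ prismPoly 0 j := polyOn_le_biDegLE j

theorem polyT1_le (i : ℤ) : polyT1 i ≤ prismPoly i 0 := by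
  have : ({3} : Set (Fin 4)) = {0, 1, 2}ᶜ := by
    ext m
    fin_cases m <;> simp
  rw [polyT1, this]
  exact polyOn_compl_le_biDegLE i

/-- The homogeneous fields satisfy x · p = 0, and for the others multiplication by x raises the
degree from `k - 1` to `k`. Only this inclusion is needed. -/
theorem nedelec_le (k : ℕ) : nedelecHom k ⊔ nedelecLow k ≤ nedelecSpace 0 k := by
  refine sup_le (Submodule.span_le.2 ?_) (Submodule.span_le.2 ?_)
  · rintro p ⟨h3, hp, hx⟩
    refine ⟨⟨fun m _ => polyT3_le k (hp m).1, ?_⟩, h3⟩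
    rw [Fin.sum_univ_four, h3, zero_mul, add_zero] at hx
    have : X 0 * p 0 + X 1 * p 1 + X 2 * p 2 = 0 := by linear_combination hx
    rw [this]
    exact zero_mem _
  · rintro p ⟨h3, hp⟩
    have hp' : ∀ m, p m ∈ prismPoly 0 (k - 1) := fun m => polyT3_le _ (hp m)
    refine ⟨⟨fun m _ => biDegLE_mono _ le_rfl (by omega) (hp' m), ?_⟩, h3⟩
    exact add_mem (add_mem (linear_mul_mem_biDegLE (X_mem_biDegLE (by simp)) (hp' 0))
      (linear_mul_mem_biDegLE (X_mem_biDegLE (by simp)) (hp' 1)))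
      (linear_mul_mem_biDegLE (X_mem_biDegLE (by simp)) (hp' 2))

theorem mem_of_mem_oneForms {k : ℕ} {E : Field4} (hE : E ∈ oneForms k) :
    IsNedelec k k E ∧ E 3 ∈ prismPoly (k - 1) k := by
  obtain ⟨A, hA, B, hB, rfl⟩ := Submodule.mem_sup.1 hE
  have hA' : A ∈ nedelecSpace k k := by
    refine Submodule.span_le.2 ?_ hA
    rintro _ ⟨a, ha, p, hp, rfl⟩
    obtain ⟨hp, hp3⟩ := nedelec_le k hp
    have mul_mem : ∀ {q}, q ∈ prismPoly 0 k → a * q ∈ prismPoly k k := fun hq => by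
      simpa using mul_mem_biDegLE (polyT1_le k ha) hq
    refine ⟨⟨fun m hm => mul_mem (hp.mem m hm), ?_⟩, by simp [hp3]⟩
    convert mul_mem hp.radial using 1
    simp only [Pi.smul_apply, smul_eq_mul]
    ring
  have hB' : B ∈ (prismPoly (k - 1) k).map (LinearMap.single ℝ (fun _ : Fin 4 => Poly4) 3) := by
    refine Submodule.span_le.2 ?_ hB
    rintro _ ⟨b, hb, rfl⟩
    rw [polyTensor_eq] at hb
    exact ⟨b, hb, rfl⟩
  obtain ⟨b, hb, rfl⟩ := hB'
  obtain ⟨hA, hA3⟩ := hA'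
  have e : ∀ m, m ≠ 3 → (A + LinearMap.single ℝ (fun _ : Fin 4 => Poly4) 3 b) m = A m := by
    intro m hm
    simp [hm]
  refine ⟨⟨fun m hm => by rw [e m hm]; exact hA.mem m hm, ?_⟩, ?_⟩
  · rw [e 0 (by decide), e 1 (by decide), e 2 (by decide)]
    exact hA.radial
  · simpa [hA3] using hb

/-! ## Consequences of vanishing trace degrees of freedom -/

theorem onHoriz_dotProduct {d : ℕ} (E : Field4) (σ : TetFace d) (z : ℝ) (s t) :
    onHoriz E σ z s ⬝ᵥ t = eval s (pull σ id (C z) (component E t)) := by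
  rw [eval_pull, eval_component, eval_C]
  rfl

theorem onVert_dotProduct {d : ℕ} (E : Field4) (σ : TetFace d) (y t) :
    onVert E σ y ⬝ᵥ t = eval y (pull σ Fin.castSucc (X (Fin.last d)) (component E t)) := by
  rw [eval_pull, eval_component, eval_X]
  rfl

theorem eval_facePoint_of_pull_horiz {d : ℕ} {σ : TetFace d} {z : ℝ} {p : Poly4}
    (h : pull σ id (C z) p = 0) (s : Fin d → ℝ) : eval (facePoint σ s z) p = 0 := by
  have := congrArg (eval s) h
  rw [eval_pull, eval_C, map_zero] at this
  exact this

theorem eval_facePoint_of_pull_vert {d : ℕ} {σ : TetFace d} {p : Poly4}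
    (h : pull σ Fin.castSucc (X (Fin.last d)) p = 0) (s : Fin d → ℝ) (z : ℝ) :
    eval (facePoint σ s z) p = 0 := by
  have := congrArg (eval (Fin.snoc s z : Fin (d + 1) → ℝ)) h
  rw [eval_pull, eval_X, map_zero] at this
  simpa using this

theorem horizInt_eq_zero {d : ℕ} {σ : TetFace d} {f : (Fin d → ℝ) → ℝ} (h : horizInt σ f = 0) :
    ∫ s in simplexDom d, f s = 0 :=
  (mul_eq_zero.1 h).resolve_left (faceJac_ne_zero σ)

theorem vertInt_eq_zero {d : ℕ} {σ : TetFace d} {f : (Fin (d + 1) → ℝ) → ℝ}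
    (h : vertInt σ f = 0) : ∫ y in prismDom d, f y = 0 :=
  (mul_eq_zero.1 h).resolve_left (faceJac_ne_zero σ)

theorem component_smul (E : Field4) (a : ℝ) (t : Fin 4 → ℝ) :
    component E (a • t) = C a * component E t := by
  simp [component, Finset.mul_sum, mul_assoc]

theorem component_e4 (E : Field4) : component E e4 = E 3 := by
  simp [component, e4, Pi.single_apply]

/-- Horizontal faces have no height parameter: there `S` is everything and the first index bounds
the degree in no variable. -/
theorem biDegLE_univ_le (ι : Type*) (i j : ℤ) :
    biDegLE (Set.univ : Set ι) i j ≤ polyOn Set.univ j := by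
  rw [← degLE_univ]
  exact inf_le_right

theorem vertPoly_eq (d : ℕ) (i j : ℤ) :
    vertPoly d i j = biDegLE (Set.range Fin.castSucc) i j := by
  rw [← polyOn_mul_polyOn, vertPoly]
  congr 2
  ext m
  refine Fin.lastCases ?_ (fun m => ?_) m <;> simp

theorem biDegLE_range_castSucc_one (i j : ℤ) :
    biDegLE (Set.range (Fin.castSucc : Fin 1 → Fin 2)) i j = polyOn {0} j * polyOn {1} i := by
  rw [← vertPoly_eq, vertPoly, mul_comm]
  congr 2
  ext m
  fin_cases m <;> simp

variable {k : ℕ} {E : Field4}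

/-- The horizontal components vanish on the horizontal facets. -/
theorem eval_eq_zero_of_traceDofs_horiz (hE : IsNedelec k k E)
    (hM : ∀ M ∈ traceDofs k, M E = 0) {z : ℝ} (hz : z = -1 ∨ z = 1) (x : Fin 4 → ℝ)
    (hx : x 3 = z) (m : Fin 4) (hm : m ≠ 3) : eval x (E m) = 0 := by
  have hC : ∀ n, (C z : MvPolynomial (Fin n) ℝ) ∈ biDegLE Set.univ 1 0 := fun n =>
    C_mem_biDegLE zero_le_one le_rfl z
  have hedge : ∀ (σ : TetFace 1) s, eval (facePoint σ s z) (component E (tangent σ 0)) = 0 := by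
    intro σ s
    refine eval_facePoint_of_pull_horiz ?_ s
    refine hE.pull_edge_eq_zero (S := Set.univ) (w := 1) (fun _ => Set.mem_univ _) (hC 1)
      (isCompact_simplexDom 1) (interior_simplexDom_nonempty 1) (by simp) one_ne_zero
      fun q hq => ?_
    have h0 := horizInt_eq_zero (hM _ (Or.inl (Or.inl (Or.inl (Or.inl (Or.inl (Or.inl
      ⟨σ, z, hz, q, biDegLE_univ_le _ _ _ hq, rfl⟩)))))))
    obtain ⟨a, ha, hu⟩ := exists_unitTangent σ
    simp only [onHoriz_dotProduct, hu, component_smul] at h0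
    have e : ∀ s, eval s (pull σ id (C z) (C a * component E (tangent σ 0))) * eval s q =
        a * eval s (1 * (pull σ id (C z) (component E (tangent σ 0)) * q)) := by
      intro s
      simp only [map_mul, eval_pull, eval_C, one_mul, mul_assoc]
    simp only [e, integral_const_mul] at h0
    exact (mul_eq_zero.1 h0).resolve_left ha
  have htri : ∀ (σ : TetFace 2) s n,
      eval (facePoint σ s z) (component E (tangent σ n)) = 0 := by
    intro σ s n
    refine eval_facePoint_of_pull_horiz ?_ s
    refine hE.pull_triangle_eq_zero (S := Set.univ) (w := 1) Function.injective_id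
      (fun _ => Set.mem_univ _) (hC 2) (isCompact_simplexDom 2) (interior_simplexDom_nonempty 2)
      (fun x hx => hx) (by simp) one_ne_zero (fun e s y => by rw [eval_C]; exact hedge e s)
      (fun q hq => ?_) n
    have h0 := horizInt_eq_zero (hM _ (Or.inl (Or.inl (Or.inl (Or.inl (Or.inr
      ⟨σ, z, hz, q, fun n => biDegLE_univ_le _ _ _ (hq n), rfl⟩))))))
    rw [← h0]
    refine integral_congr_ae (.of_forall fun s => ?_)
    simp [onHoriz_dotProduct, mul_comm]
  refine hE.eval_eq_zero_of_height htri (fun q hq => ?_) x hx m hm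
  have h0 := horizInt_eq_zero (hM _ (Or.inl (Or.inl (Or.inr
    ⟨RelEmbedding.refl _, z, hz, q, fun n => biDegLE_univ_le _ _ _ (hq n), rfl⟩))))
  rw [← h0]
  refine integral_congr_ae (.of_forall fun s => ?_)
  simp [dotProduct_sum, onHoriz_dotProduct, mul_comm]

theorem eval_bubbleT1 (x : Fin 4 → ℝ) : eval x bubbleT1 = (1 - x 3) / 2 * ((1 + x 3) / 2) := by
  simp [bubbleT1]
  ring

/-- The horizontal part is the segment bubble times a Nédélec field. -/
theorem exists_bubbleT1_mul (hE : IsNedelec k k E) (hM : ∀ M ∈ traceDofs k, M E = 0) :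
    ∃ F : Field4, IsNedelec (k - 2) k F ∧ ∀ m, m ≠ 3 → E m = bubbleT1 * F m := by
  have a1 : IsAffine (3 : Fin 4) (C (1 / 2) * (1 - X 3)) :=
    ⟨-1 / 2, by norm_num, 1, by simp, by
      have : (C (-1 / 2) : Poly4) = -C (1 / 2) := by
        rw [← map_neg]
        norm_num
      rw [this]
      ring⟩
  have a2 : IsAffine (3 : Fin 4) (C (1 / 2) * (1 + X 3)) :=
    ⟨1 / 2, by norm_num, -1, by simp, by ring⟩
  have n1 : (C (1 / 2) * (1 - X 3) : Poly4) ∉ degLE ({0, 1, 2} : Set (Fin 4))ᶜ 0 :=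
    notMem_degLE_zero (i := 3) (by simp) (by simp [coeff_C_mul, coeff_X, coeff_single_one])
  have n2 : (C (1 / 2) * (1 + X 3) : Poly4) ∉ degLE ({0, 1, 2} : Set (Fin 4))ᶜ 0 :=
    notMem_degLE_zero (i := 3) (by simp) (by simp [coeff_C_mul, coeff_X, coeff_single_one])
  have hdiv : ∀ m : Fin 4, m ≠ 3 → bubbleT1 ∣ E m := by
    intro m hm
    -- The factors 1 ± x₄ divide because the horizontal part vanishes on x₄ = ∓1; at x₄ = -1 one
    -- factor is zero and the other is not.
    refine a2.mul_dvd (a2.dvd_of_eval_eq_zero fun x hx => ?_)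
      (a1.dvd_of_eval_eq_zero fun x hx => ?_) (fun _ => -1) (by simp) (by simp)
    · refine eval_eq_zero_of_traceDofs_horiz hE hM (Or.inl rfl) x ?_ m hm
      simp at hx
      linarith
    · refine eval_eq_zero_of_traceDofs_horiz hE hM (Or.inr rfl) x ?_ m hm
      simp at hx
      linarith
  have hmem : ∀ {p}, bubbleT1 * p ∈ prismPoly k k → p ∈ prismPoly (k - 2) k := by
    intro p hp
    rw [bubbleT1, mul_assoc] at hp
    convert mem_biDegLE_of_linear_mul_compl (ne_zero_of_notMem n2) n2
      (mem_biDegLE_of_linear_mul_compl (ne_zero_of_notMem n1) n1 hp) using 2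
    ring
  choose! F hF using hdiv
  refine ⟨F, ⟨fun m hm => hmem (hF m hm ▸ hE.mem m hm), hmem ?_⟩, hF⟩
  have := hE.radial
  rw [hF 0 (by decide), hF 1 (by decide), hF 2 (by decide)] at this
  convert this using 1
  ring

theorem pull_bubbleT1_nonneg {d : ℕ} (σ : TetFace d) {y : Fin (d + 1) → ℝ} (hy : y ∈ prismDom d) :
    0 ≤ eval y (pull σ Fin.castSucc (X (Fin.last d)) bubbleT1) := by
  rw [eval_pull, eval_bubbleT1, facePoint_three, eval_X]
  have h1 := hy.2.1
  have h2 := hy.2.2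
  exact mul_nonneg (by linarith) (by linarith)

theorem pull_bubbleT1_ne_zero {d : ℕ} (σ : TetFace d) :
    pull σ Fin.castSucc (X (Fin.last d)) bubbleT1 ≠ 0 := by
  intro h
  have := eval_facePoint_of_pull_vert h 0 0
  rw [eval_bubbleT1, facePoint_three] at this
  norm_num at this

theorem component_eq_mul {F : Field4} {b : Poly4} (h : ∀ m, m ≠ 3 → E m = b * F m)
    {t : Fin 4 → ℝ} (ht : t 3 = 0) : component E t = b * component F t := by
  rw [component_of_three ht, component_of_three ht, h 0 (by decide), h 1 (by decide),
    h 2 (by decide)]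
  ring

/-- The horizontal part is a combination of the bubbles `Φʳ ϑᵇ(x₄) Nʳ`. -/
theorem exists_horiz_bubble (hE : IsNedelec k k E) (hM : ∀ M ∈ traceDofs k, M E = 0) :
    ∃ g : Fin 3 → Poly4, (∀ r, g r ∈ polyTensor ((k : ℤ) - 2) ((k : ℤ) - 3)) ∧
      ∀ m, m ≠ 3 → E m = ∑ r, g r * phiB r * bubbleT1 * whitney r m := by
  obtain ⟨F, hF, hEF⟩ := exists_bubbleT1_mul hE hM
  have hX : ∀ d, (X (Fin.last d) : MvPolynomial (Fin (d + 1)) ℝ) ∈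
      biDegLE (Set.range Fin.castSucc) 1 0 := fun d => X_mem_biDegLE_compl (by simp)
  have hedge : ∀ (σ : TetFace 1) s z, eval (facePoint σ s z) (component F (tangent σ 0)) = 0 := by
    intro σ s z
    refine eval_facePoint_of_pull_vert ?_ s z
    refine hF.pull_edge_eq_zero (S := Set.range Fin.castSucc)
      (w := pull σ Fin.castSucc (X (Fin.last 1)) bubbleT1) (fun n => ⟨n, rfl⟩) (hX 1)
      (isCompact_prismDom 1) (interior_prismDom_nonempty 1)
      (fun y hy => pull_bubbleT1_nonneg σ hy) (pull_bubbleT1_ne_zero σ) fun q hq => ?_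
    rw [biDegLE_range_castSucc_one] at hq
    -- Taking q₁ = 0 leaves the moments of E · τ. They are moments of F · τ with weight ϑᵇ(x₄), and
    -- F · τ has degree `k - 1` along the edge and `k - 2` in height, exactly as q₂.
    have h0 := vertInt_eq_zero (hM _ (Or.inl (Or.inl (Or.inl (Or.inr
      ⟨σ, 0, zero_mem _, q, hq, rfl⟩)))))
    obtain ⟨a, ha, hu⟩ := exists_unitTangent σ
    simp only [onVert_dotProduct, hu, component_smul, component_eq_mul hEF (tangent_three σ 0)]
      at h0
    have e : ∀ s, eval s (pull σ Fin.castSucc (X (Fin.last 1)) (component E e4)) *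
        eval s (0 : MvPolynomial (Fin 2) ℝ) + -eval s (pull σ Fin.castSucc (X (Fin.last 1))
          (C a * (bubbleT1 * component F (tangent σ 0)))) * eval s q =
        -a * eval s (pull σ Fin.castSucc (X (Fin.last 1)) bubbleT1 *
          (pull σ Fin.castSucc (X (Fin.last 1)) (component F (tangent σ 0)) * q)) := by
      intro s
      rw [map_mul, ← algebraMap_eq, AlgHom.commutes]
      simp [algebraMap_eq, mul_assoc]
    simp only [e, integral_const_mul] at h0
    exact (mul_eq_zero.1 h0).resolve_left (neg_ne_zero.2 ha)
  have htri : ∀ (σ : TetFace 2) s z n,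
      eval (facePoint σ s z) (component F (tangent σ n)) = 0 := by
    intro σ s z n
    refine eval_facePoint_of_pull_vert ?_ s z
    -- F has height degree `k - 2`, so the test fields of the triangle argument have degree `k - 2`
    -- in both groups of variables, as in the moments of the first kind.
    refine hF.pull_triangle_eq_zero (S := Set.range Fin.castSucc)
      (w := pull σ Fin.castSucc (X (Fin.last 2)) bubbleT1) (Fin.castSucc_injective 2)
      (fun n => ⟨n, rfl⟩) (hX 2)
      (isCompact_prismDom 2) (interior_prismDom_nonempty 2) (fun y hy => hy.1)
      (fun y hy => pull_bubbleT1_nonneg σ hy) (pull_bubbleT1_ne_zero σ)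
      (fun e s y => hedge e s _) (fun q hq => ?_) n
    have h0 := vertInt_eq_zero (hM _ (Or.inl (Or.inr
      ⟨σ, q, fun n => by rw [vertPoly_eq]; exact hq n, rfl⟩)))
    rw [← h0]
    refine integral_congr_ae (.of_forall fun s => ?_)
    simp only [dotProduct_sum, dotProduct_smul, onVert_dotProduct,
      component_eq_mul hEF (tangent_three σ _), map_mul, map_sum, Finset.mul_sum, smul_eq_mul]
    exact Finset.sum_congr rfl fun n _ => by ring
  obtain ⟨g, hg, hgF⟩ := hF.exists_bubble htri
  refine ⟨g, fun r => by rw [polyTensor_eq]; exact hg r, fun m hm => ?_⟩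
  rw [hEF m hm, hgF m hm, Finset.mul_sum]
  exact Finset.sum_congr rfl fun r _ => by ring

/-- The vertical component is a multiple of the tetrahedron bubble. -/
theorem exists_vert_bubble (hE : E 3 ∈ prismPoly (k - 1) k) (hM : ∀ M ∈ traceDofs k, M E = 0) :
    ∃ p ∈ polyTensor ((k : ℤ) - 1) ((k : ℤ) - 4), E 3 = bubbleT3 * p := by
  have hX : ∀ d, (X (Fin.last d) : MvPolynomial (Fin (d + 1)) ℝ) ∈
      biDegLE (Set.range Fin.castSucc) 1 0 := fun d => X_mem_biDegLE_compl (by simp)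
  have hpull : ∀ {d} (σ : TetFace d), pull σ Fin.castSucc (X (Fin.last d)) (E 3) ∈
      biDegLE (Set.range Fin.castSucc) (k - 1) k :=
    fun {d} σ => pull_mem (S := Set.range Fin.castSucc) (fun n => ⟨n, rfl⟩) (hX d) hE
  have hvert : ∀ (σ : TetFace 0) s z, eval (facePoint σ s z) (E 3) = 0 := by
    intro σ s z
    refine eval_facePoint_of_pull_vert ?_ s z
    refine eq_zero_of_moments (isCompact_prismDom 0) (interior_prismDom_nonempty 0) (w := 1)
      (by simp) one_ne_zero (V := polyOn Set.univ (k - 1)) ?_ fun q hq => ?_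
    · have := (hpull σ).1
      rwa [show (Set.range (Fin.castSucc : Fin 0 → Fin 1))ᶜ = Set.univ by simp, degLE_univ] at this
    · have h0 := vertInt_eq_zero (hM _ (Or.inl (Or.inl (Or.inl (Or.inl (Or.inl (Or.inr
        ⟨σ, q, hq, rfl⟩)))))))
      simpa [onVert_dotProduct, component_e4] using h0
  have hedge : ∀ (σ : TetFace 1) s z, eval (facePoint σ s z) (E 3) = 0 := by
    intro σ s z
    refine eval_facePoint_of_pull_vert ?_ s z
    -- E₄ vanishes on the two vertical sides; the quotient by their product has degree `k - 2` along
    -- the edge and `k - 1` in height, which matches q₁ (with q₂ = 0).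
    refine eq_zero_of_edge_moments (isCompact_prismDom 1) (interior_prismDom_nonempty 1)
      (S := Set.range Fin.castSucc) (a := Fin.castSucc 0) ⟨0, rfl⟩ (fun x hx => ?_) (hpull σ) ?_ ?_
      fun q hq => ?_
    · have := simplexDom_subset 1 hx.1
      exact ⟨this.1 0, this.2 0⟩
    · refine (isAffine_X _).dvd_of_eval_eq_zero fun x hx => ?_
      rw [eval_X] at hx
      rw [eval_pull, facePoint_subface_succ σ 0 hx]
      exact hvert _ _ _
    · refine (isAffine_one_sub_X _).dvd_of_eval_eq_zero fun x hx => ?_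
      simp only [map_sub, map_one, eval_X] at hx
      have hs : ∑ n : Fin 1, x n.castSucc = 1 := by
        rw [Fin.sum_univ_one]
        linarith
      rw [eval_pull, facePoint_subface_zero σ hs]
      exact hvert _ _ _
    · rw [biDegLE_range_castSucc_one] at hq
      have h0 := vertInt_eq_zero (hM _ (Or.inl (Or.inl (Or.inl (Or.inr
        ⟨σ, q, hq, 0, zero_mem _, rfl⟩)))))
      simpa [onVert_dotProduct, component_e4] using h0
  have hface : ∀ (σ : TetFace 2) s z, eval (facePoint σ s z) (E 3) = 0 := by
    intro σ s z
    refine eval_facePoint_of_pull_vert ?_ s z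
    have hab : (Fin.castSucc 0 : Fin 3) ≠ Fin.castSucc 1 := by decide
    refine eq_zero_of_face_moments (isCompact_prismDom 2) (interior_prismDom_nonempty 2)
      (S := Set.range Fin.castSucc) hab ⟨0, rfl⟩ ⟨1, rfl⟩ (fun x hx => ?_) (hpull σ) ?_ ?_ ?_
      fun q hq => ?_
    · have h2 := hx.1.2
      rw [Fin.sum_univ_two] at h2
      exact ⟨hx.1.1 0, hx.1.1 1, h2⟩
    · refine (isAffine_X _).dvd_of_eval_eq_zero fun x hx => ?_
      rw [eval_X] at hx
      rw [eval_pull, facePoint_subface_succ σ 0 hx]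
      exact hedge _ _ _
    · refine (isAffine_X _).dvd_of_eval_eq_zero fun x hx => ?_
      rw [eval_X] at hx
      rw [eval_pull, facePoint_subface_succ σ 1 hx]
      exact hedge _ _ _
    · refine (isAffine_one_sub_X_sub_X hab).dvd_of_eval_eq_zero fun x hx => ?_
      simp only [map_sub, map_one, eval_X] at hx
      have hs : ∑ n : Fin 2, x n.castSucc = 1 := by
        rw [Fin.sum_univ_two]
        linarith
      rw [eval_pull, facePoint_subface_zero σ hs]
      exact hedge _ _ _
    · have h0 := vertInt_eq_zero (hM _ (Or.inr ⟨σ, q, by rw [vertPoly_eq]; exact hq, rfl⟩))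
      simpa [onVert_dotProduct, component_e4, mul_comm] using h0
  have hdvd : ∀ n, bary n ∣ E 3 := fun n => by
    refine (isAffine_bary n).dvd_of_eval_eq_zero fun x hx => ?_
    obtain ⟨s, hs⟩ := exists_facePoint_of_bary_eq_zero hx
    rw [hs]
    exact hface _ _ _
  have h01 := bary_mul_bary_dvd (by decide) (hdvd 0) (hdvd 1)
  have h012 : bary 0 * bary 1 * bary 2 ∣ E 3 :=
    (isAffine_bary 2).mul_dvd (hdvd 2) h01 ![0, 0, -1, 0] (by simp [eval_bary])
      (by simp [eval_bary])
  -- The point has barycentric coordinates (1, 1, -1, 0): on λ₃ = 0 and off the other three planes.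
  obtain ⟨p, hp⟩ : bubbleT3 ∣ E 3 :=
    (isAffine_bary 3).mul_dvd (hdvd 3) h012 ![1, 1, -3, 0] (by simp [eval_bary]; norm_num)
      (by simp [eval_bary]; norm_num)
  refine ⟨p, ?_, hp⟩
  rw [hp, bubbleT3, mul_assoc, mul_assoc, mul_assoc] at hE
  rw [polyTensor_eq]
  convert mem_of_bary_mul (mem_of_bary_mul (mem_of_bary_mul (mem_of_bary_mul hE))) using 2
  ring

/-! ## Unisolvence -/

theorem mem_oneFormBubbles {g : Fin 3 → Poly4}
    (hg : ∀ r, g r ∈ polyTensor ((k : ℤ) - 2) ((k : ℤ) - 3))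
    (hgE : ∀ m, m ≠ 3 → E m = ∑ r, g r * phiB r * bubbleT1 * whitney r m) {p : Poly4}
    (hp : p ∈ polyTensor ((k : ℤ) - 1) ((k : ℤ) - 4)) (hpE : E 3 = bubbleT3 * p) :
    E ∈ oneFormBubbles k := by
  have e : E = ∑ r, (g r * phiB r * bubbleT1) • whitney r + Pi.single 3 (bubbleT3 * p) := by
    ext1 m
    by_cases hm : m = 3
    · subst hm
      simp [hpE, whitney_three]
    · simp [hm, hgE m hm]
  rw [e]
  refine add_mem (Submodule.mem_sup_left (sum_mem fun r _ => ?_)) (Submodule.mem_sup_right ?_)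
  · refine Submodule.mul_induction_on
      (C := fun q => (q * phiB r * bubbleT1) • whitney r ∈ Submodule.span ℝ _) (hg r)
      (fun a ha b hb => Submodule.subset_span ⟨r, b, hb, a, ha, ?_⟩) fun a b ha hb => ?_
    · exact congrArg (· • whitney r) (by ring)
    · rw [add_mul, add_mul, add_smul]
      exact add_mem ha hb
  · refine Submodule.mul_induction_on
      (C := fun q => (Pi.single 3 (bubbleT3 * q) : Field4) ∈ Submodule.span ℝ _) hp
      (fun a ha b hb => Submodule.subset_span ⟨b, hb, a, ha, ?_⟩) fun a b ha hb => ?_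
    · exact congrArg (Pi.single 3) (by ring)
    · rw [mul_add, Pi.single_add]
      exact add_mem ha hb

/-- The volume test fields with coefficients `g` and `p` are the horizontal and vertical parts of
`E` itself, so the moments are the integrals of E₁² + E₂² + E₃² and of E₄². -/
theorem eq_zero_of_volDofs {g : Fin 3 → Poly4}
    (hg : ∀ r, g r ∈ polyTensor ((k : ℤ) - 2) ((k : ℤ) - 3))
    (hgE : ∀ m, m ≠ 3 → E m = ∑ r, g r * phiB r * bubbleT1 * whitney r m) {p : Poly4}
    (hp : p ∈ polyTensor ((k : ℤ) - 1) ((k : ℤ) - 4)) (hpE : E 3 = bubbleT3 * p)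
    (hM : ∀ M ∈ volDofs₁ k ∪ volDofs₂ k, M E = 0) : E = 0 := by
  have hW : ∀ m, (∑ r, (g r * phiB r * bubbleT1) • whitney r) m = if m = 3 then 0 else E m := by
    intro m
    split_ifs with hm
    · subst hm
      simp [whitney_three]
    · simp [hgE m hm]
  have h1 : ∫ x in prism, eval x (∑ m : Fin 3, 1 * E m.castSucc ^ 2) = 0 := by
    rw [← hM _ (Or.inl ⟨g, hg, rfl⟩)]
    refine integral_congr_ae (.of_forall fun x => ?_)
    simp only [fieldAt, dotProduct, hW]
    simp [Fin.sum_univ_castSucc, Fin.ext_iff, sq]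
  have h2 : ∫ x in prism, eval x (∑ m : Fin 1, 1 * E 3 ^ 2) = 0 := by
    rw [← hM _ (Or.inr ⟨p, hp, rfl⟩)]
    refine integral_congr_ae (.of_forall fun x => ?_)
    simp only [fieldAt, dotProduct, mul_comm p, ← hpE]
    simp [Fin.sum_univ_four, sq]
  ext1 m
  refine Fin.lastCases ?_ (fun m => ?_) m
  · exact eq_zero_of_integral_sum_sq isCompact_prism interior_prism_nonempty (by simp) h2 (m := 0)
      one_ne_zero
  · exact eq_zero_of_integral_sum_sq isCompact_prism interior_prism_nonempty (by simp) h1 (m := m)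
      one_ne_zero

end TetPrism

theorem mainTheorem5 (k : ℕ) :
    (∀ E ∈ TetPrism.oneForms k, (∀ M ∈ TetPrism.traceDofs k, M E = 0) →
      E ∈ TetPrism.oneFormBubbles k) ∧
    (∀ E ∈ TetPrism.oneForms k, (∀ M ∈ TetPrism.oneFormDofs k, M E = 0) → E = 0) := by
  refine ⟨fun E hE hM => ?_, fun E hE hM => ?_⟩
  · obtain ⟨h, h3⟩ := TetPrism.mem_of_mem_oneForms hE
    obtain ⟨g, hg, hgE⟩ := TetPrism.exists_horiz_bubble h hM
    obtain ⟨p, hp, hpE⟩ := TetPrism.exists_vert_bubble h3 hM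
    exact TetPrism.mem_oneFormBubbles hg hgE hp hpE
  · obtain ⟨h, h3⟩ := TetPrism.mem_of_mem_oneForms hE
    have hM' : ∀ M ∈ TetPrism.traceDofs k, M E = 0 := fun M hMk => hM M (Or.inl hMk)
    obtain ⟨g, hg, hgE⟩ := TetPrism.exists_horiz_bubble h hM'
    obtain ⟨p, hp, hpE⟩ := TetPrism.exists_vert_bubble h3 hM'
    exact TetPrism.eq_zero_of_volDofs hg hgE hp hpE fun M hMk => hM M (Or.inr hMk)
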